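/- All codes are binary and linear. Let $C=C^\perp\subseteq\mathbb{F}_2^n$ be a self-dual code (with respect to the standard inner product). It is singly even if it has a codeword of weight $\equiv 2\pmod 4$. The minimum weight $d(D)$ of a set $D\subseteq\mathbb{F}_2^n$ is the least non-zero weight of a vector in $D$; an $[n,m,d]$ code is a code of length $n$, dimension $m$ and minimum weight $d$. A self-dual code $C$ of length $n$ is extremal if $d(C)=4\lfloor n/24\rfloor+4$ when $n\not\equiv 22\pmod{24}$, and $d(C)=4\lfloor n/24\rfloor+6$ when $n\equiv 22\pmod{24}$. For a singly even self-dual code $C$, let $C_0$ be the subcode of codewords of weight $\equiv 0\pmod 4$, and let $S=C_0^\perp\setminus C$ be the shadow of $C$. The code $C$ is $s$-extremal if $d(S)=n/2+4-2d(C)$, or, in the case that $n\equiv 22\pmod{24}$ and $d(C)=4\lfloor n/24\rfloor+6$, if $d(S)=n/2+8-2d(C)$. Two self-dual codes $C,C'$ of length $n$ are neighbors if $\dim(C\cap C')=n/2-1$. Let $k\ge 0$ be an integer and let $C$ be a code as in (i), (ii) or (iii) below. Then there are cosets $C_1,C_2,C_3$ of $C_0$ such that $C_0^\perp=C_0\cup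 C_1\cup C_2\cup C_3$, $C=C_0\cup C_2$ and $S=C_1\cup C_3$; and for every choice of such cosets, the sets $N_1(C)=C_0\cup C_1$ and $N_3(C)=C_0\cup C_3$ are self-dual codes that are neighbors of $C$, and the following hold. (i) If $C$ is an $s$-extremal singly even self-dual $[24k+4,12k+2,4k+2]$ code, then $N_1(C)$ and $N_3(C)$ are also $s$-extremal singly even self-dual $[24k+4,12k+2,4k+2]$ codes. (ii) If $C$ is an $s$-extremal and extremal singly even self-dual $[24k+20,12k+10,4k+4]$ code, then $N_1(C)$ and $N_3(C)$ are also $s$-extremal and extremal singly even self-dual $[24k+20,12k+10,4k+4]$ codes. (iii) If $C$ is an $s$-extremal singly even self-dual $[24k+12,12k+6,4k+2]$ code, then $N_1(C)$ and $N_3(C)$ are $s$-extremal and extremal singly even self-dual $[24k+12,12k+6,4k+4]$ codes. -/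

import Mathlib

/-- The set of vectors of length `n` over the binary field. -/
abbrev BinaryVector (n : ℕ) : Type := Fin n → ZMod 2

/-- A binary (linear) code of length `n`. -/
abbrev BinaryCode (n : ℕ) : Type := Submodule (ZMod 2) (BinaryVector n)

namespace BinaryCode

/-- The dual `D^⊥` of a set `D` of vectors, with respect to the standard inner product. -/
def dual {n : ℕ} (D : Set (BinaryVector n)) : BinaryCode n where
  carrier := {x | ∀ y ∈ D, x ⬝ᵥ y = 0}
  add_mem' := by
    intro a b ha hb y hy
    rw [add_dotProduct, ha y hy, hb y hy, add_zero]
  zero_mem' := by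
    intro y _
    exact zero_dotProduct y
  smul_mem' := by
    intro c x hx y hy
    rw [smul_dotProduct, hx y hy, smul_zero]

/-- `C` is self-dual: `C = C^⊥`. -/
def IsSelfDual {n : ℕ} (C : BinaryCode n) : Prop :=
  C = dual (C : Set (BinaryVector n))

/-- `C` is a singly even self-dual code: self-dual, with at least one codeword of
weight `≡ 2 (mod 4)`. -/
def IsSinglyEvenSelfDual {n : ℕ} (C : BinaryCode n) : Prop :=
  IsSelfDual C ∧ ∃ x ∈ C, hammingNorm x % 4 = 2

/-- `d` is the minimum weight `d(D)` of `D`, the least non-zero weight of a vector in `D`. -/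
def HasMinWeight {n : ℕ} (D : Set (BinaryVector n)) (d : ℕ) : Prop :=
  IsLeast {w : ℕ | w ≠ 0 ∧ ∃ x ∈ D, hammingNorm x = w} d

/-- `C` is an `[n, m, d]` code, `n` being its length. -/
def HasParameters {n : ℕ} (C : BinaryCode n) (m d : ℕ) : Prop :=
  Module.finrank (ZMod 2) C = m ∧ HasMinWeight (C : Set (BinaryVector n)) d

/-- The self-dual code `C` is extremal: its minimum weight is `4⌊n/24⌋ + 6` if
`n ≡ 22 (mod 24)`, and `4⌊n/24⌋ + 4` otherwise. -/
def IsExtremal {n : ℕ} (C : BinaryCode n) : Prop :=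
  IsSelfDual C ∧
    HasMinWeight (C : Set (BinaryVector n))
      (if n % 24 = 22 then 4 * (n / 24) + 6 else 4 * (n / 24) + 4)

/-- `C₀`, the set of codewords of `C` of weight `≡ 0 (mod 4)`. -/
def doublyEvenPart {n : ℕ} (C : BinaryCode n) : Set (BinaryVector n) :=
  {x | x ∈ C ∧ hammingNorm x % 4 = 0}

/-- The shadow `S = C₀^⊥ \ C`. -/
def shadow {n : ℕ} (C : BinaryCode n) : Set (BinaryVector n) :=
  (dual (doublyEvenPart C) : Set (BinaryVector n)) \ (C : Set (BinaryVector n))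

/-- `C` is an `s`-extremal singly even self-dual code: `d(S) = n/2 + 4 - 2 d(C)`, except that
`d(S) = n/2 + 8 - 2 d(C)` if `n ≡ 22 (mod 24)` and `d(C) = 4⌊n/24⌋ + 6`. (The length `n` of a
self-dual code is even.) -/
def IsSExtremal {n : ℕ} (C : BinaryCode n) : Prop :=
  IsSinglyEvenSelfDual C ∧
    ∃ d s : ℕ, HasMinWeight (C : Set (BinaryVector n)) d ∧ HasMinWeight (shadow C) s ∧
      s + 2 * d = if n % 24 = 22 ∧ d = 4 * (n / 24) + 6 then n / 2 + 8 else n / 2 + 4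

/-- `D` is a coset `v + C₀` of `C₀`. -/
def IsDoublyEvenCoset {n : ℕ} (C : BinaryCode n) (D : Set (BinaryVector n)) : Prop :=
  ∃ v : BinaryVector n, D = (fun c => v + c) '' doublyEvenPart C

/-- `C₁, C₂, C₃` are cosets of `C₀` with `C₀^⊥ = C₀ ∪ C₁ ∪ C₂ ∪ C₃`, where
`C = C₀ ∪ C₂` and `S = C₁ ∪ C₃`. -/
structure IsCosetDecomposition {n : ℕ} (C : BinaryCode n)
    (C₁ C₂ C₃ : Set (BinaryVector n)) : Prop where
  coset_one : IsDoublyEvenCoset C C₁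
  coset_two : IsDoublyEvenCoset C C₂
  coset_three : IsDoublyEvenCoset C C₃
  dual_eq : (dual (doublyEvenPart C) : Set (BinaryVector n)) =
    doublyEvenPart C ∪ C₁ ∪ C₂ ∪ C₃
  code_eq : (C : Set (BinaryVector n)) = doublyEvenPart C ∪ C₂
  shadow_eq : shadow C = C₁ ∪ C₃

/-- Self-dual codes `C`, `C'` of length `n` are neighbors if `dim (C ∩ C') = n/2 - 1`. -/
def IsNeighbor {n : ℕ} (C C' : BinaryCode n) : Prop :=
  IsSelfDual C ∧ IsSelfDual C' ∧
    Module.finrank (ZMod 2) (C ⊓ C' : BinaryCode n) + 1 = n / 2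

/-- The sets `N₁(C) = C₀ ∪ C₁` and `N₃(C) = C₀ ∪ C₃` are linear codes, are neighbors of `C`,
and have the property `P`. The cosets `C₁, C₂, C₃` exist, and the assertion holds for every
choice of their labels. -/
def ShadowNeighborsSatisfy {n : ℕ} (C : BinaryCode n) (P : BinaryCode n → Prop) : Prop :=
  (∃ C₁ C₂ C₃ : Set (BinaryVector n), IsCosetDecomposition C C₁ C₂ C₃) ∧
    ∀ C₁ C₂ C₃ : Set (BinaryVector n), IsCosetDecomposition C C₁ C₂ C₃ →
      ∃ N₁ N₃ : BinaryCode n,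
        (N₁ : Set (BinaryVector n)) = doublyEvenPart C ∪ C₁ ∧
        (N₃ : Set (BinaryVector n)) = doublyEvenPart C ∪ C₃ ∧
        IsNeighbor C N₁ ∧ IsNeighbor C N₃ ∧ P N₁ ∧ P N₃

end BinaryCode

/-!
Let `m` be the dimension of `C` and `s` a lower bound for the weights in its shadow. Up to a scalar
the weight enumerator of the shadow is that of `C` composed with a linear substitution, so that
`(x² + y²)^s` divides the enumerator of `C`; the quotient is invariant under the dihedral group of
order 16 generated by `y ↦ -y` and the Hadamard substitution, hence a combination of the products
`(x² + y²)^(m - s - 4j) (x² y² (x² - y²)²)^j` with `j ≤ (m - s) / 4`. If moreover `s + 2d > m + 4`,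
these few coefficients are determined by the vanishing of the low weights of `C`, and Lagrange
inversion shows that they do not exist unless `n ≡ 22 (mod 24)`. This is the Bachoc–Gaborit bound
`s + 2d ≤ n / 2 + 4`.

The weights in the shadow are all congruent to `m ≡ 2 (mod 4)`, so each neighbor `N = C₀ ∪ C₁` is
singly even. Its words come from `C₀` and the shadow of `C`, and those of its shadow from `C₂` and
the shadow of `C`. The resulting lower bounds for the minimum weights of `N` and of its shadow have
equality in the Bachoc–Gaborit bound, so they are attained.
-/

namespace BinaryCode

section Weight

variable {ι : Type*} [Fintype ι]

theorem hammingNorm_eq_sum (x : ι → ZMod 2) :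
    hammingNorm x = ∑ i, if x i ≠ 0 then 1 else 0 := by
  simp only [hammingNorm, Finset.card_filter]

theorem hammingNorm_add_add_two_mul (x y : ι → ZMod 2) :
    hammingNorm (x + y) + 2 * hammingNorm (x * y) = hammingNorm x + hammingNorm y := by
  have bitwise : ∀ a b : ZMod 2, (if a + b ≠ 0 then 1 else 0) + 2 * (if a * b ≠ 0 then 1 else 0) =
      (if a ≠ 0 then 1 else 0) + if b ≠ 0 then 1 else 0 := by decide
  simp only [hammingNorm_eq_sum, Finset.mul_sum, ← Finset.sum_add_distrib]
  exact Finset.sum_congr rfl fun i _ => bitwise (x i) (y i)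

theorem dotProduct_eq_hammingNorm_mul (x y : ι → ZMod 2) :
    x ⬝ᵥ y = (hammingNorm (x * y) : ZMod 2) := by
  have bitwise : ∀ a : ZMod 2, a = ((if a ≠ 0 then 1 else 0 : ℕ) : ZMod 2) := by decide
  rw [hammingNorm_eq_sum, Nat.cast_sum, dotProduct]
  exact Finset.sum_congr rfl fun i _ => bitwise (x i * y i)

theorem dotProduct_eq_zero_iff_even (x y : ι → ZMod 2) :
    x ⬝ᵥ y = 0 ↔ Even (hammingNorm (x * y)) := by
  rw [dotProduct_eq_hammingNorm_mul, ZMod.natCast_eq_zero_iff_even]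

theorem dotProduct_self_eq_zero_iff_even (x : ι → ZMod 2) :
    x ⬝ᵥ x = 0 ↔ Even (hammingNorm x) := by
  have bitwise : ∀ a : ZMod 2, a * a = a := by decide
  rw [dotProduct_eq_zero_iff_even, show x * x = x from funext fun i => bitwise (x i)]

theorem hammingNorm_add_mod_four (x y : ι → ZMod 2) :
    hammingNorm (x + y) % 4 =
      (hammingNorm x + hammingNorm y + if x ⬝ᵥ y = 0 then 0 else 2) % 4 := by
  have := hammingNorm_add_add_two_mul x y
  simp only [dotProduct_eq_zero_iff_even, Nat.even_iff]
  split_ifs <;> omega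

end Weight

section Shadow

variable {n : ℕ} {C : BinaryCode n}

theorem mem_image_add_left_iff {D : Set (BinaryVector n)} {v x : BinaryVector n} :
    x ∈ (fun c => v + c) '' D ↔ v + x ∈ D := by
  rw [Set.image_add_left, ZModModule.neg_eq_self v, Set.mem_preimage]

namespace IsSelfDual

theorem dotProduct_eq_zero (hC : IsSelfDual C) {x y : BinaryVector n} (hx : x ∈ C) (hy : y ∈ C) :
    x ⬝ᵥ y = 0 := by
  rw [hC] at hx
  exact hx y hy

theorem even_hammingNorm (hC : IsSelfDual C) {x : BinaryVector n} (hx : x ∈ C) :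
    Even (hammingNorm x) :=
  (dotProduct_self_eq_zero_iff_even x).1 (hC.dotProduct_eq_zero hx hx)

theorem two_mul_finrank (hC : IsSelfDual C) : 2 * Module.finrank (ZMod 2) C = n := by
  let e := dotProductEquiv (ZMod 2) (Fin n)
  have annihilator : C.map e.toLinearMap = C.dualAnnihilator := by
    ext f
    obtain ⟨x, rfl⟩ := e.surjective f
    rw [Submodule.mem_map_equiv, e.symm_apply_apply, Submodule.mem_dualAnnihilator]
    conv_lhs => rw [hC]
    rfl
  have := Subspace.finrank_add_finrank_dualAnnihilator_eq C
  rwa [← annihilator, LinearEquiv.finrank_map_eq, ← two_mul, Module.finrank_fin_fun] at this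

theorem hammingNorm_add_mod_four (hC : IsSelfDual C) {x y : BinaryVector n} (hx : x ∈ C)
    (hy : y ∈ C) : hammingNorm (x + y) % 4 = (hammingNorm x + hammingNorm y) % 4 := by
  rw [BinaryCode.hammingNorm_add_mod_four, if_pos (hC.dotProduct_eq_zero hx hy), add_zero]

theorem exists_dotProduct_eq_zero_iff (hC : IsSelfDual C) :
    ∃ v : BinaryVector n, ∀ c ∈ C, v ⬝ᵥ c = 0 ↔ hammingNorm c % 4 = 0 := by
  have even (c : C) := Nat.even_iff.1 (hC.even_hammingNorm c.2)
  let halfWeight : C →+ ZMod 2 :=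
    { toFun := fun c => (hammingNorm (c : BinaryVector n) / 2 : ℕ)
      map_zero' := by simp
      map_add' := fun x y => by
        rw [← Nat.cast_add, ZMod.natCast_eq_natCast_iff']
        have := hC.hammingNorm_add_mod_four x.2 y.2
        have := even x
        have := even y
        simp only [Submodule.coe_add]
        omega }
  obtain ⟨f, hf⟩ := (halfWeight.toZModLinearMap 2).exists_extend
  obtain ⟨v, rfl⟩ := (dotProductEquiv (ZMod 2) (Fin n)).surjective f
  refine ⟨v, fun c hc => ?_⟩
  have value : v ⬝ᵥ c = (hammingNorm c / 2 : ℕ) := LinearMap.congr_fun hf ⟨c, hc⟩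
  rw [value, ZMod.natCast_eq_zero_iff_even, Nat.even_iff]
  have : hammingNorm c % 2 = 0 := even ⟨c, hc⟩
  omega

end IsSelfDual

theorem zero_mem_doublyEvenPart : (0 : BinaryVector n) ∈ doublyEvenPart C :=
  ⟨C.zero_mem, by simp only [hammingNorm_zero]⟩

namespace IsSinglyEvenSelfDual

theorem mem_shadow_iff_dotProduct (hC : IsSinglyEvenSelfDual C) {v : BinaryVector n} :
    v ∈ shadow C ↔ ∀ c ∈ C, v ⬝ᵥ c = 0 ↔ hammingNorm c % 4 = 0 := by
  obtain ⟨hC, t, ht, ht'⟩ := hC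
  constructor
  · rintro ⟨hv, hvC⟩ c hc
    refine ⟨fun h0 => ?_, fun hc4 => hv c ⟨hc, hc4⟩⟩
    by_contra hc4
    refine hvC (hC ▸ fun y hy => ?_)
    by_cases hy4 : hammingNorm y % 4 = 0
    · exact hv y ⟨hy, hy4⟩
    · have := Nat.even_iff.1 (hC.even_hammingNorm hy)
      have := Nat.even_iff.1 (hC.even_hammingNorm hc)
      have := hv (y + c) ⟨C.add_mem hy hc, by
        rw [hC.hammingNorm_add_mod_four hy hc]
        omega⟩
      rwa [dotProduct_add, h0, add_zero] at this
  · refine fun hv => ⟨fun c hc => (hv c hc.1).2 hc.2, fun hvC => ?_⟩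
    have := (hv t ht).1 (hC.dotProduct_eq_zero hvC ht)
    omega

theorem shadow_nonempty (hC : IsSinglyEvenSelfDual C) : (shadow C).Nonempty :=
  hC.1.exists_dotProduct_eq_zero_iff.imp fun _ => hC.mem_shadow_iff_dotProduct.2

theorem mem_shadow_iff_add_mem (hC : IsSinglyEvenSelfDual C) {v u : BinaryVector n}
    (hv : v ∈ shadow C) : u ∈ shadow C ↔ v + u ∈ C := by
  have parity : ∀ a b : ZMod 2, a + b = 0 ↔ (a = 0 ↔ b = 0) := by decide
  rw [hC.mem_shadow_iff_dotProduct] at hv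
  conv_rhs => rw [hC.1]
  refine hC.mem_shadow_iff_dotProduct.trans (forall₂_congr fun c hc => ?_)
  rw [add_dotProduct, parity, hv c hc]
  exact iff_comm

theorem hammingNorm_shadow_add_mod_four (hC : IsSinglyEvenSelfDual C) {v c : BinaryVector n}
    (hv : v ∈ shadow C) (hc : c ∈ C) : hammingNorm (v + c) % 4 = hammingNorm v % 4 := by
  have := Nat.even_iff.1 (hC.1.even_hammingNorm hc)
  rw [hammingNorm_add_mod_four]
  simp only [hC.mem_shadow_iff_dotProduct.1 hv c hc]
  split_ifs <;> omega

theorem mem_dual_doublyEvenPart_iff (hC : IsSinglyEvenSelfDual C) {x : BinaryVector n} :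
    x ∈ dual (doublyEvenPart C) ↔ x ∈ C ∨ x ∈ shadow C := by
  constructor
  · exact fun hx => or_iff_not_imp_left.2 fun hxC => ⟨hx, hxC⟩
  · rintro (hx | hx)
    · exact fun y hy => hC.1.dotProduct_eq_zero hx hy.1
    · exact hx.1

theorem exists_mem_iff_doublyEvenPart (hC : IsSinglyEvenSelfDual C) :
    ∃ t, ∀ c, c ∈ C ↔ c ∈ doublyEvenPart C ∨ t + c ∈ doublyEvenPart C := by
  obtain ⟨hC, t, ht, ht4⟩ := hC
  refine ⟨t, fun c => ⟨fun hc => ?_, fun hc => ?_⟩⟩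
  · have := Nat.even_iff.1 (hC.even_hammingNorm hc)
    have := hC.hammingNorm_add_mod_four ht hc
    by_cases hc4 : hammingNorm c % 4 = 0
    · exact Or.inl ⟨hc, hc4⟩
    · exact Or.inr ⟨C.add_mem ht hc, by omega⟩
  · exact hc.elim And.left fun htc => (C.add_mem_iff_right ht).1 htc.1

theorem exists_isCosetDecomposition (hC : IsSinglyEvenSelfDual C) :
    ∃ C₁ C₂ C₃, IsCosetDecomposition C C₁ C₂ C₃ := by
  obtain ⟨v, hv⟩ := hC.shadow_nonempty
  obtain ⟨t, ht⟩ := hC.exists_mem_iff_doublyEvenPart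
  have mem_shadow (u) :
      u ∈ shadow C ↔ v + u ∈ doublyEvenPart C ∨ v + t + u ∈ doublyEvenPart C := by
    rw [hC.mem_shadow_iff_add_mem hv, ht, add_comm v t, add_assoc]
  refine ⟨_, _, _, ⟨v, rfl⟩, ⟨t, rfl⟩, ⟨v + t, rfl⟩, ?_, ?_, ?_⟩ <;> ext u <;>
    simp only [SetLike.mem_coe, Set.mem_union, mem_image_add_left_iff,
      hC.mem_dual_doublyEvenPart_iff, ht, mem_shadow]
  tauto

end IsSinglyEvenSelfDual

namespace IsCosetDecomposition

variable {C₁ C₂ C₃ : Set (BinaryVector n)}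

theorem swap (h : IsCosetDecomposition C C₁ C₂ C₃) : IsCosetDecomposition C C₃ C₂ C₁ where
  coset_one := h.coset_three
  coset_two := h.coset_two
  coset_three := h.coset_one
  dual_eq := by rw [h.dual_eq, Set.union_right_comm, Set.union_right_comm _ C₁,
    Set.union_right_comm (doublyEvenPart C ∪ C₃)]
  code_eq := h.code_eq
  shadow_eq := by rw [h.shadow_eq, Set.union_comm]

theorem exists_mem_shadow (h : IsCosetDecomposition C C₁ C₂ C₃) :
    ∃ v ∈ shadow C, C₁ = (fun c => v + c) '' doublyEvenPart C := by
  obtain ⟨v, rfl⟩ := h.coset_one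
  refine ⟨v, ?_, rfl⟩
  rw [h.shadow_eq]
  exact Or.inl ⟨0, zero_mem_doublyEvenPart, add_zero v⟩

end IsCosetDecomposition

/-- For a shadow vector `v` of even weight this is the code `C₀ ∪ (v + C₀)`, that is, `N₁(C)` or
`N₃(C)`; defining it as the dual of `C₀ ∪ {v}` makes linearity automatic. -/
def shadowNeighbor (C : BinaryCode n) (v : BinaryVector n) : BinaryCode n :=
  dual (insert v (doublyEvenPart C))

section ShadowNeighbor

variable {v x : BinaryVector n}

theorem mem_shadowNeighbor :
    x ∈ shadowNeighbor C v ↔ x ⬝ᵥ v = 0 ∧ x ∈ dual (doublyEvenPart C) :=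
  Set.forall_mem_insert

namespace IsSinglyEvenSelfDual

theorem doublyEvenPart_subset_shadowNeighbor (hC : IsSinglyEvenSelfDual C) (hv : v ∈ shadow C) :
    doublyEvenPart C ⊆ shadowNeighbor C v := fun c hc =>
  mem_shadowNeighbor.2 ⟨dotProduct_comm c v ▸ hv.1 c hc,
    hC.mem_dual_doublyEvenPart_iff.2 (Or.inl hc.1)⟩

theorem self_mem_shadowNeighbor (hv : v ∈ shadow C) (even : Even (hammingNorm v)) :
    v ∈ shadowNeighbor C v :=
  mem_shadowNeighbor.2 ⟨(dotProduct_self_eq_zero_iff_even v).2 even, hv.1⟩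

theorem coe_shadowNeighbor (hC : IsSinglyEvenSelfDual C) (hv : v ∈ shadow C)
    (even : Even (hammingNorm v)) :
    (shadowNeighbor C v : Set (BinaryVector n)) =
      doublyEvenPart C ∪ (fun c => v + c) '' doublyEvenPart C := by
  have pairing := hC.mem_shadow_iff_dotProduct.1 hv
  ext x
  simp only [SetLike.mem_coe, Set.mem_union]
  constructor
  · rw [mem_shadowNeighbor, hC.mem_dual_doublyEvenPart_iff, dotProduct_comm, mem_image_add_left_iff]
    rintro ⟨hxv, hx | hx⟩
    · exact Or.inl ⟨hx, (pairing x hx).1 hxv⟩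
    · have hvx := (hC.mem_shadow_iff_add_mem hv).1 hx
      refine Or.inr ⟨hvx, (pairing _ hvx).1 ?_⟩
      rw [dotProduct_add, (dotProduct_self_eq_zero_iff_even v).2 even, hxv, add_zero]
  · have subset := hC.doublyEvenPart_subset_shadowNeighbor hv
    rintro (hx | ⟨c, hc, rfl⟩)
    · exact subset hx
    · exact add_mem (self_mem_shadowNeighbor hv even) (subset hc)

theorem isSelfDual_shadowNeighbor (hC : IsSinglyEvenSelfDual C) (hv : v ∈ shadow C)
    (even : Even (hammingNorm v)) : IsSelfDual (shadowNeighbor C v) := by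
  refine le_antisymm (fun x hx y hy => ?_) fun x hx y hy => ?_
  · rw [hC.coe_shadowNeighbor hv even] at hy
    obtain ⟨hxv, hx⟩ := mem_shadowNeighbor.1 hx
    obtain hy | ⟨c, hc, rfl⟩ := hy
    · exact hx y hy
    · rw [dotProduct_add, hxv, hx c hc, add_zero]
  · exact hx y <| Set.insert_subset (self_mem_shadowNeighbor hv even)
      (hC.doublyEvenPart_subset_shadowNeighbor hv) hy

theorem isSinglyEvenSelfDual_shadowNeighbor (hC : IsSinglyEvenSelfDual C) (hv : v ∈ shadow C)
    (hv4 : hammingNorm v % 4 = 2) : IsSinglyEvenSelfDual (shadowNeighbor C v) :=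
  have even : Even (hammingNorm v) := Nat.even_iff.2 (by omega)
  ⟨hC.isSelfDual_shadowNeighbor hv even, v, self_mem_shadowNeighbor hv even, hv4⟩

theorem mem_or_mem_of_mem_shadowNeighbor (hC : IsSinglyEvenSelfDual C) (hv : v ∈ shadow C)
    (hx : x ∈ shadowNeighbor C v) : x ∈ doublyEvenPart C ∨ x ∈ shadow C := by
  obtain ⟨hxv, hx⟩ := mem_shadowNeighbor.1 hx
  refine (hC.mem_dual_doublyEvenPart_iff.1 hx).imp_left fun hxC => ⟨hxC, ?_⟩
  rwa [← hC.mem_shadow_iff_dotProduct.1 hv x hxC, dotProduct_comm]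

theorem mem_or_mem_of_mem_shadow_shadowNeighbor (hC : IsSinglyEvenSelfDual C) (hv : v ∈ shadow C)
    (hx : x ∈ shadow (shadowNeighbor C v)) : x ∈ (C : Set _) \ doublyEvenPart C ∨ x ∈ shadow C := by
  have subset := hC.doublyEvenPart_subset_shadowNeighbor hv
  have hx_dual : x ∈ dual (doublyEvenPart C) := fun c hc => hx.1 c ⟨subset hc, hc.2⟩
  exact (hC.mem_dual_doublyEvenPart_iff.1 hx_dual).imp_left fun hxC =>
    ⟨hxC, fun h => hx.2 (subset h)⟩

theorem finrank_inf_shadowNeighbor_add_one (hC : IsSinglyEvenSelfDual C) (hv : v ∈ shadow C) :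
    Module.finrank (ZMod 2) (C ⊓ shadowNeighbor C v : BinaryCode n) + 1 =
      Module.finrank (ZMod 2) C := by
  let f : Module.Dual (ZMod 2) C := (dotProductEquiv (ZMod 2) (Fin n) v).domRestrict C
  have inf_eq : C ⊓ shadowNeighbor C v = f.ker.map C.subtype := by
    ext x
    simp only [Submodule.mem_inf, mem_shadowNeighbor, dotProduct_comm x v, Submodule.mem_map,
      LinearMap.mem_ker, Submodule.subtype_apply, Subtype.exists, exists_and_right, exists_eq_right]
    exact ⟨fun h => ⟨h.1, h.2.1⟩,
      fun ⟨hx, h⟩ => ⟨hx, h, hC.mem_dual_doublyEvenPart_iff.2 (Or.inl hx)⟩⟩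
  have f_ne_zero : f ≠ 0 := by
    obtain ⟨t, ht, ht4⟩ := hC.2
    intro h
    have := (hC.mem_shadow_iff_dotProduct.1 hv t ht).1 (LinearMap.congr_fun h ⟨t, ht⟩)
    omega
  rw [inf_eq, Submodule.finrank_map_subtype_eq,
    Module.Dual.finrank_ker_add_one_of_ne_zero f_ne_zero]

theorem isNeighbor_shadowNeighbor (hC : IsSinglyEvenSelfDual C) (hv : v ∈ shadow C)
    (even : Even (hammingNorm v)) : IsNeighbor C (shadowNeighbor C v) := by
  refine ⟨hC.1, hC.isSelfDual_shadowNeighbor hv even, ?_⟩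
  rw [hC.finrank_inf_shadowNeighbor_add_one hv]
  have := hC.1.two_mul_finrank
  omega

theorem shadowNeighborsSatisfy (hC : IsSinglyEvenSelfDual C)
    (even : ∀ v ∈ shadow C, Even (hammingNorm v)) {P : BinaryCode n → Prop}
    (hP : ∀ v ∈ shadow C, P (shadowNeighbor C v)) : ShadowNeighborsSatisfy C P := by
  refine ⟨hC.exists_isCosetDecomposition, fun C₁ C₂ C₃ h => ?_⟩
  obtain ⟨v, hv, rfl⟩ := h.exists_mem_shadow
  obtain ⟨w, hw, rfl⟩ := h.swap.exists_mem_shadow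
  exact ⟨shadowNeighbor C v, shadowNeighbor C w, hC.coe_shadowNeighbor hv (even v hv),
    hC.coe_shadowNeighbor hw (even w hw), hC.isNeighbor_shadowNeighbor hv (even v hv),
    hC.isNeighbor_shadowNeighbor hw (even w hw), hP v hv, hP w hw⟩

end IsSinglyEvenSelfDual

end ShadowNeighbor

end Shadow

section Enumerator

open MvPolynomial

section Substitution

variable (K : Type*) [CommRing K]

/-- The nontrivial character `a ↦ (-1) ^ a` of the binary field, with values in `K`. -/
def signChar : AddChar (ZMod 2) K :=
  AddChar.zmodChar 2 (ζ := -1) neg_one_sq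

variable {K}

@[to_additive]
theorem prod_zmod_two {M : Type*} [CommMonoid M] (f : ZMod 2 → M) : ∏ a, f a = f 0 * f 1 :=
  Fin.prod_univ_two f

/-- The substitution `(x, y) ↦ (x + y, x - y)` of the MacWilliams identity. Binary forms are
polynomials in `x = X 0` and `y = X 1` with the variables indexed by `ZMod 2`, which makes this
substitution a Fourier transform. -/
noncomputable def hadamard : MvPolynomial (ZMod 2) K →ₐ[K] MvPolynomial (ZMod 2) K :=
  aeval fun a => ∑ b, C (signChar K (a * b)) * X b

theorem hadamard_X (a : ZMod 2) :
    hadamard (X a : MvPolynomial (ZMod 2) K) = ∑ b, C (signChar K (a * b)) * X b :=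
  aeval_X _ a

theorem signChar_one : signChar K 1 = -1 := by
  rw [signChar, AddChar.zmodChar_apply, ZMod.val_one, pow_one]

@[simp]
theorem hadamard_X_zero : hadamard (X 0 : MvPolynomial (ZMod 2) K) = X 0 + X 1 := by
  simp only [hadamard_X, sum_zmod_two, zero_mul, AddChar.map_zero_eq_one, C_1, one_mul]

@[simp]
theorem hadamard_X_one : hadamard (X 1 : MvPolynomial (ZMod 2) K) = X 0 - X 1 := by
  simp only [hadamard_X, sum_zmod_two, one_mul, AddChar.map_zero_eq_one,
    signChar_one, C_neg, C_1, neg_mul, ← sub_eq_add_neg]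

/-- The substitution `(x, y) ↦ (x, ζ y)`. -/
noncomputable def twist (ζ : K) : MvPolynomial (ZMod 2) K →ₐ[K] MvPolynomial (ZMod 2) K :=
  aeval fun a => C (ζ ^ a.val) * X a

@[simp]
theorem twist_X_zero (ζ : K) : twist ζ (X 0) = X 0 := by
  rw [twist, aeval_X, ZMod.val_zero, pow_zero, C_1, one_mul]

@[simp]
theorem twist_X_one (ζ : K) : twist ζ (X 1) = C ζ * X 1 := by
  rw [twist, aeval_X, ZMod.val_one, pow_one]

end Substitution

section WeightEnumerator

variable {n : ℕ} {K : Type*} [CommRing K]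

/-- The monomial `x ^ (n - wt u) * y ^ wt u` of a vector `u`. -/
noncomputable def weightMonomial (K : Type*) [CommRing K] (u : BinaryVector n) :
    MvPolynomial (ZMod 2) K :=
  ∏ i, X (u i)

theorem weightMonomial_eq (u : BinaryVector n) :
    weightMonomial K u = X 0 ^ (n - hammingNorm u) * X 1 ^ hammingNorm u := by
  have split (a : ZMod 2) :
      (X a : MvPolynomial (ZMod 2) K) = if a ≠ 0 then X 1 else X 0 := by
    fin_cases a <;> rfl
  have zeros : (Finset.univ.filter fun i => ¬u i ≠ 0).card = n - hammingNorm u := by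
    rw [← Finset.compl_filter, Finset.card_compl, Fintype.card_fin, hammingNorm]
  rw [weightMonomial, Finset.prod_congr rfl fun i _ => split (u i), Finset.prod_ite,
    Finset.prod_const, Finset.prod_const, zeros, mul_comm]
  rfl

theorem isHomogeneous_weightMonomial (u : BinaryVector n) :
    (weightMonomial K u).IsHomogeneous n := by
  have := IsHomogeneous.prod Finset.univ _ _ fun i _ => isHomogeneous_X K (u i)
  rwa [Finset.sum_const, Finset.card_univ, Fintype.card_fin, smul_eq_mul, mul_one] at this

theorem twist_weightMonomial (ζ : K) (u : BinaryVector n) :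
    twist ζ (weightMonomial K u) = C (ζ ^ hammingNorm u) * weightMonomial K u := by
  simp only [weightMonomial_eq, map_mul, map_pow, twist_X_zero, twist_X_one, mul_pow]
  ring

theorem signChar_dotProduct (u w : BinaryVector n) :
    signChar K (u ⬝ᵥ w) = ∏ i, signChar K (u i * w i) :=
  map_prod (signChar K).toMonoidHom (fun i => Multiplicative.ofAdd (u i * w i)) Finset.univ

theorem hadamard_weightMonomial (u : BinaryVector n) :
    hadamard (weightMonomial K u) = ∑ w, C (signChar K (u ⬝ᵥ w)) * weightMonomial K w := by
  simp only [weightMonomial, map_prod, hadamard_X, Fintype.prod_sum, Finset.prod_mul_distrib,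
    signChar_dotProduct, map_prod]

/-- The homogeneous weight enumerator of a set of vectors. -/
noncomputable def weightEnumerator (K : Type*) [CommRing K] (D : Set (BinaryVector n)) :
    MvPolynomial (ZMod 2) K :=
  ∑ u ∈ D.toFinite.toFinset, weightMonomial K u

theorem isHomogeneous_weightEnumerator (D : Set (BinaryVector n)) :
    (weightEnumerator K D).IsHomogeneous n :=
  IsHomogeneous.sum _ _ _ fun u _ => isHomogeneous_weightMonomial u

theorem X_one_pow_dvd_weightEnumerator {D : Set (BinaryVector n)} {s : ℕ}
    (hs : ∀ u ∈ D, s ≤ hammingNorm u) : X 1 ^ s ∣ weightEnumerator K D := by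
  refine Finset.dvd_sum fun u hu => ?_
  rw [weightMonomial_eq]
  exact dvd_mul_of_dvd_right (pow_dvd_pow _ (hs u (D.toFinite.mem_toFinset.1 hu))) _

theorem twist_weightEnumerator {D : Set (BinaryVector n)} {ζ ε : K}
    (h : ∀ u ∈ D, ζ ^ hammingNorm u = ε) :
    twist ζ (weightEnumerator K D) = C ε * weightEnumerator K D := by
  rw [weightEnumerator, map_sum, Finset.mul_sum]
  refine Finset.sum_congr rfl fun u hu => ?_
  rw [twist_weightMonomial, h u (D.toFinite.mem_toFinset.1 hu)]

variable {D : BinaryCode n}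

theorem sum_signChar_dotProduct_eq_zero [IsDomain K] [NeZero (2 : K)] {w : BinaryVector n}
    (hw : w ∉ dual (D : Set (BinaryVector n))) :
    ∑ c ∈ (D : Set (BinaryVector n)).toFinite.toFinset, signChar K (c ⬝ᵥ w) = 0 := by
  classical
  let ψ : AddChar D K := (signChar K).compAddMonoidHom
    ((dotProductEquiv (ZMod 2) (Fin n) w).domRestrict D).toAddMonoidHom
  have ψ_ne_zero : ψ ≠ 0 := by
    intro hψ
    refine hw fun y hy => of_not_not fun hwy => two_ne_zero (α := K) ?_
    have : signChar K (w ⬝ᵥ y) = 1 := DFunLike.congr_fun hψ ⟨y, hy⟩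
    rw [Fin.eq_one_of_ne_zero (w ⬝ᵥ y : ZMod 2) hwy] at this
    linear_combination signChar_one (K := K) - this
  have := ψ.sum_eq_ite
  rw [if_neg ψ_ne_zero] at this
  rw [← this, Finset.sum_subtype _ (fun c => (Set.toFinite _).mem_toFinset)]
  exact Finset.sum_congr rfl fun c _ => congrArg (signChar K) (dotProduct_comm _ _)

theorem sum_signChar_dotProduct_of_mem_dual {w : BinaryVector n}
    (hw : w ∈ dual (D : Set (BinaryVector n))) :
    ∑ c ∈ (D : Set (BinaryVector n)).toFinite.toFinset, signChar K (c ⬝ᵥ w) = Nat.card D := by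
  have trivial : ∀ c ∈ (D : Set (BinaryVector n)).toFinite.toFinset, signChar K (c ⬝ᵥ w) = 1 :=
    fun c hc => by
      rw [dotProduct_comm, hw c ((Set.toFinite _).mem_toFinset.1 hc), AddChar.map_zero_eq_one]
  rw [Finset.sum_congr rfl trivial, Finset.sum_const, nsmul_one,
    ← Nat.card_eq_card_finite_toFinset]
  rfl

theorem hadamard_weightEnumerator_coset [IsDomain K] [NeZero (2 : K)] (v : BinaryVector n) :
    hadamard (weightEnumerator K ((fun c => v + c) '' (D : Set (BinaryVector n)))) =
      C (Nat.card D : K) * ∑ w ∈ (dual (D : Set (BinaryVector n)) : Set _).toFinite.toFinset,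
        C (signChar K (v ⬝ᵥ w)) * weightMonomial K w := by
  classical
  have coefficient (w : BinaryVector n) :
      ∑ c ∈ (D : Set (BinaryVector n)).toFinite.toFinset,
          C (signChar K ((v + c) ⬝ᵥ w)) * weightMonomial K w =
        C (signChar K (v ⬝ᵥ w)) * weightMonomial K w *
          C (∑ c ∈ (D : Set (BinaryVector n)).toFinite.toFinset, signChar K (c ⬝ᵥ w)) := by
    rw [map_sum, Finset.mul_sum]
    refine Finset.sum_congr rfl fun c _ => ?_
    rw [add_dotProduct, AddChar.map_add_eq_mul, C_mul, mul_right_comm]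
  rw [weightEnumerator, Set.Finite.toFinset_image _ (Set.toFinite _) (Set.toFinite _),
    Finset.sum_image (add_right_injective v).injOn, map_sum]
  simp only [hadamard_weightMonomial]
  rw [Finset.sum_comm, Finset.mul_sum, Finset.sum_congr rfl fun w _ => coefficient w]
  refine (Finset.sum_subset (Finset.subset_univ _) fun w _ hw => ?_).symm.trans
    (Finset.sum_congr rfl fun w hw => ?_) <;> rw [Set.Finite.mem_toFinset] at hw
  · rw [sum_signChar_dotProduct_eq_zero hw, C_0, mul_zero]
  · rw [sum_signChar_dotProduct_of_mem_dual hw, mul_comm]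

end WeightEnumerator

section SelfDual

variable {n : ℕ} {C : BinaryCode n}

theorem natCard_eq_two_pow_finrank (C : BinaryCode n) :
    Nat.card C = 2 ^ Module.finrank (ZMod 2) C := by
  rw [Module.natCard_eq_pow_finrank (K := ZMod 2), Nat.card_zmod]

theorem card_toFinset_eq_two_pow_finrank (C : BinaryCode n) :
    (C : Set (BinaryVector n)).toFinite.toFinset.card = 2 ^ Module.finrank (ZMod 2) C := by
  rw [← Nat.card_eq_card_finite_toFinset, ← natCard_eq_two_pow_finrank]
  rfl

theorem IsSelfDual.hadamard_weightEnumerator {K : Type*} [CommRing K] [IsDomain K]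
    [NeZero (2 : K)] (hC : IsSelfDual C) :
    hadamard (weightEnumerator K (C : Set (BinaryVector n))) =
      MvPolynomial.C (2 ^ Module.finrank (ZMod 2) C) *
        weightEnumerator K (C : Set (BinaryVector n)) := by
  have := hadamard_weightEnumerator_coset (K := K) (D := C) 0
  simp only [zero_add, Set.image_id', zero_dotProduct, AddChar.map_zero_eq_one, C_1, one_mul,
    natCard_eq_two_pow_finrank, Nat.cast_pow, Nat.cast_ofNat] at this
  rwa [← hC] at this

theorem I_pow_eq_I_pow_iff {a b : ℕ} : Complex.I ^ a = Complex.I ^ b ↔ a % 4 = b % 4 := by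
  have orderOf_I : orderOf Complex.I = 2 ^ (1 + 1) :=
    orderOf_eq_prime_pow (by norm_num [Complex.ext_iff]) Complex.I_pow_four
  rw [Complex.I_pow_eq_pow_mod, Complex.I_pow_eq_pow_mod b]
  refine (pow_injOn_Iio_orderOf (x := Complex.I)).eq_iff ?_ ?_ <;>
    exact Set.mem_Iio.2 (orderOf_I ▸ Nat.mod_lt _ four_pos)

theorem eval_hadamard_weightMonomial {K : Type*} [CommRing K] {z : ZMod 2 → K} {ζ : K}
    (add : z 0 + z 1 = 1) (sub : z 0 - z 1 = ζ) (u : BinaryVector n) :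
    eval z (hadamard (weightMonomial K u)) = ζ ^ hammingNorm u := by
  simp only [weightMonomial_eq, map_mul, map_pow, hadamard_X_zero, hadamard_X_one, map_add,
    map_sub, eval_X, add, sub, one_pow, one_mul]

theorem eval_twist_weightMonomial {K : Type*} [CommRing K] {z : ZMod 2 → K} {ζ : K}
    (h : ζ * z 1 = z 0) (u : BinaryVector n) :
    eval z (twist ζ (weightMonomial K u)) = z 0 ^ n := by
  have le : hammingNorm u ≤ n := hammingNorm_le_card_fintype.trans_eq (Fintype.card_fin n)
  simp only [weightMonomial_eq, map_mul, map_pow, twist_X_zero, twist_X_one, eval_X, eval_C, h]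
  rw [← pow_add, Nat.sub_add_cancel le]

namespace IsSinglyEvenSelfDual

variable {v : BinaryVector n}

theorem shadow_eq_image_add (hC : IsSinglyEvenSelfDual C) (hv : v ∈ shadow C) :
    shadow C = (fun c => v + c) '' (C : Set (BinaryVector n)) :=
  Set.ext fun _ => (hC.mem_shadow_iff_add_mem hv).trans mem_image_add_left_iff.symm

theorem signChar_dotProduct_of_mem_shadow (hC : IsSinglyEvenSelfDual C) (hv : v ∈ shadow C)
    {c : BinaryVector n} (hc : c ∈ C) :
    signChar ℂ (v ⬝ᵥ c) = Complex.I ^ hammingNorm c := by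
  have pairing := hC.mem_shadow_iff_dotProduct.1 hv c hc
  have even := Nat.even_iff.1 (hC.1.even_hammingNorm hc)
  rw [Complex.I_pow_eq_pow_mod]
  by_cases hc4 : hammingNorm c % 4 = 0
  · rw [pairing.2 hc4, hc4, AddChar.map_zero_eq_one, pow_zero]
  · rw [Fin.eq_one_of_ne_zero (v ⬝ᵥ c : ZMod 2) (mt pairing.1 hc4),
      show hammingNorm c % 4 = 2 by omega, Complex.I_sq]
    exact signChar_one

theorem hadamard_weightEnumerator_shadow (hC : IsSinglyEvenSelfDual C) :
    hadamard (weightEnumerator ℂ (shadow C)) =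
      MvPolynomial.C (2 ^ Module.finrank (ZMod 2) C) *
        twist Complex.I (weightEnumerator ℂ (C : Set (BinaryVector n))) := by
  obtain ⟨v, hv⟩ := hC.shadow_nonempty
  rw [hC.shadow_eq_image_add hv, hadamard_weightEnumerator_coset, natCard_eq_two_pow_finrank,
    ← hC.1, Nat.cast_pow, Nat.cast_ofNat, weightEnumerator, map_sum]
  congr 1
  refine Finset.sum_congr rfl fun c hc => ?_
  rw [twist_weightMonomial,
    hC.signChar_dotProduct_of_mem_shadow hv ((Set.toFinite _).mem_toFinset.1 hc)]

theorem card_toFinset_shadow (hC : IsSinglyEvenSelfDual C) :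
    (shadow C).toFinite.toFinset.card = 2 ^ Module.finrank (ZMod 2) C := by
  obtain ⟨v, hv⟩ := hC.shadow_nonempty
  rw [← Nat.card_eq_card_finite_toFinset, hC.shadow_eq_image_add hv,
    Nat.card_image_of_injective (add_right_injective v)]
  exact natCard_eq_two_pow_finrank C

theorem hammingNorm_mod_four_of_mem_shadow (hC : IsSinglyEvenSelfDual C) (hv : v ∈ shadow C) :
    hammingNorm v % 4 = Module.finrank (ZMod 2) C % 4 := by
  let z : ZMod 2 → ℂ := fun a => if a = 0 then (1 + Complex.I) / 2 else (1 - Complex.I) / 2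
  have z_zero : z 0 = (1 + Complex.I) / 2 := if_pos rfl
  have z_one : z 1 = (1 - Complex.I) / 2 := if_neg one_ne_zero
  have shadow_term : ∀ u ∈ (shadow C).toFinite.toFinset,
      eval z (hadamard (weightMonomial ℂ u)) = Complex.I ^ hammingNorm v := by
    intro u hu
    rw [Set.Finite.mem_toFinset, hC.mem_shadow_iff_add_mem hv] at hu
    have weight := hC.hammingNorm_shadow_add_mod_four hv hu
    rw [← add_assoc, ZModModule.add_self, zero_add] at weight
    rw [eval_hadamard_weightMonomial (ζ := Complex.I) (by rw [z_zero, z_one]; ring)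
      (by rw [z_zero, z_one]; ring), I_pow_eq_I_pow_iff.2 weight]
  have code_term : ∀ c ∈ (C : Set (BinaryVector n)).toFinite.toFinset,
      eval z (twist Complex.I (weightMonomial ℂ c)) = z 0 ^ n := fun c _ =>
    eval_twist_weightMonomial
      (by rw [z_zero, z_one]; linear_combination -(1 / 2) * Complex.I_mul_I) c
  have identity := congrArg (eval z) hC.hadamard_weightEnumerator_shadow
  rw [weightEnumerator, weightEnumerator, map_mul, eval_C, map_sum, map_sum, map_sum, map_sum,
    Finset.sum_eq_card_nsmul shadow_term, Finset.sum_eq_card_nsmul code_term,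
    hC.card_toFinset_shadow, card_toFinset_eq_two_pow_finrank, nsmul_eq_mul, nsmul_eq_mul,
    Nat.cast_pow, Nat.cast_ofNat, mul_right_inj' (pow_ne_zero _ two_ne_zero)] at identity
  have square : 2 * z 0 ^ 2 = Complex.I := by
    rw [z_zero]
    linear_combination (1 / 2 : ℂ) * Complex.I_mul_I
  have length : z 0 ^ n = (z 0 ^ 2) ^ Module.finrank (ZMod 2) C := by
    rw [← pow_mul, hC.1.two_mul_finrank]
  rw [← I_pow_eq_I_pow_iff, identity, length, ← mul_pow, square]

end IsSinglyEvenSelfDual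

end SelfDual

section BinaryForms

variable {K : Type*} [CommRing K]

theorem coeff_twist (ζ : K) (F : MvPolynomial (ZMod 2) K) (d : ZMod 2 →₀ ℕ) :
    coeff d (twist ζ F) = ζ ^ d 1 * coeff d F := by
  classical
  induction F using MvPolynomial.induction_on' with
  | monomial e a =>
    have twist_monomial : twist ζ (monomial e a) = monomial e (ζ ^ e 1 * a) := by
      simp only [monomial_eq, Finsupp.prod_fintype _ _ fun _ => pow_zero _, prod_zmod_two,
        map_mul, map_pow, twist_X_zero, twist_X_one, algHom_C, algebraMap_eq]
      ring
    rw [twist_monomial, coeff_monomial, coeff_monomial]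
    split_ifs with h
    · rw [h]
    · rw [mul_zero]
  | add p q hp hq => rw [map_add, coeff_add, coeff_add, hp, hq, mul_add]

theorem twist_twist (ζ ξ : K) (F : MvPolynomial (ZMod 2) K) :
    twist ζ (twist ξ F) = twist (ζ * ξ) F := by
  ext d
  simp only [coeff_twist, mul_pow, mul_assoc]

theorem twist_one (F : MvPolynomial (ZMod 2) K) : twist 1 F = F := by
  ext d
  rw [coeff_twist, one_pow, one_mul]

theorem X_pow_dvd_iff {σ : Type*} {i : σ} {k : ℕ} {F : MvPolynomial σ K} :
    X i ^ k ∣ F ↔ ∀ d, d i < k → coeff d F = 0 := by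
  rw [X_pow_eq_monomial, monomial_one_dvd_iff_modMonomial_eq_zero, MvPolynomial.ext_iff]
  refine forall_congr' fun d => ?_
  by_cases h : Finsupp.single i k ≤ d
  · simp only [coeff_modMonomial_of_le F h, coeff_zero, (Finsupp.single_le_iff.1 h).not_gt,
      false_imp_iff]
  · simp only [coeff_modMonomial_of_not_le F h, coeff_zero,
      lt_of_not_ge (mt Finsupp.single_le_iff.2 h), true_imp_iff]

theorem exists_isHomogeneous_mul_of_dvd {σ : Type*} {P F : MvPolynomial σ K} {a b : ℕ}
    (hP : P.IsHomogeneous a) (hF : F.IsHomogeneous (a + b)) (h : P ∣ F) :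
    ∃ G : MvPolynomial σ K, G.IsHomogeneous b ∧ F = P * G := by
  obtain ⟨G, rfl⟩ := h
  refine ⟨homogeneousComponent b G, homogeneousComponent_isHomogeneous b G, ?_⟩
  let := gradedAlgebra (σ := σ) (R := K)
  have component := DirectSum.coe_decompose_mul_of_left_mem_of_le
    (𝒜 := homogeneousSubmodule σ K) (b := G) hP (Nat.le_add_right a b)
  rw [DirectSum.decompose_of_mem_same _ hF, Nat.add_sub_cancel_left] at component
  exact component.trans (congrArg (P * ·) (decomposition.decompose'_apply G b))

variable [IsDomain K]

theorem eq_zero_of_dvd_of_isHomogeneous {σ : Type*} {P F : MvPolynomial σ K} {a b : ℕ}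
    (hP : P.IsHomogeneous a) (hF : F.IsHomogeneous b) (h : P ∣ F) (hba : b < a) : F = 0 := by
  obtain ⟨G, rfl⟩ := h
  by_contra ne
  have degree := totalDegree_mul_of_isDomain (left_ne_zero_of_mul ne) (right_ne_zero_of_mul ne)
  rw [hF.totalDegree ne, hP.totalDegree (left_ne_zero_of_mul ne)] at degree
  omega

theorem isRelPrime_linear {a b c d : K} (h : IsUnit (a * d - b * c)) :
    IsRelPrime (C a * X 0 + C b * X 1 : MvPolynomial (ZMod 2) K) (C c * X 0 + C d * X 1) := by
  have unit : IsUnit (C (a * d - b * c) : MvPolynomial (ZMod 2) K) := h.map C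
  have isRelPrime_X : IsRelPrime (X 0 : MvPolynomial (ZMod 2) K) (X 1) := by
    rw [X_prime.irreducible.isRelPrime_iff_not_dvd, X_dvd_X]
    exact zero_ne_one
  intro g hg hg'
  refine isRelPrime_X (unit.dvd_mul_left.1 ?_) (unit.dvd_mul_left.1 ?_)
  · refine ((hg.mul_left (C d)).sub (hg'.mul_left (C b))).trans (dvd_of_eq ?_)
    simp only [map_sub, map_mul]
    ring
  · refine ((hg'.mul_left (C a)).sub (hg.mul_left (C c))).trans (dvd_of_eq ?_)
    simp only [map_sub, map_mul]
    ring

end BinaryForms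

section Gleason

variable {K : Type*} [Field K]

/-- A Gleason invariant is a form of degree `2 * m` with the symmetries of the weight enumerator
of a self-dual code of dimension `m`: it is even in `y` and satisfies the MacWilliams identity. -/
structure IsGleasonInvariant (m : ℕ) (F : MvPolynomial (ZMod 2) K) : Prop where
  isHomogeneous : F.IsHomogeneous (2 * m)
  twist_eq : twist (-1) F = F
  hadamard_eq : hadamard F = C (2 ^ m) * F

/-- The Gleason invariant `x² + y²` of degree `2`. -/
noncomputable def gleasonQuadratic (K : Type*) [Field K] : MvPolynomial (ZMod 2) K :=
  X 0 ^ 2 + X 1 ^ 2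

/-- The Gleason invariant `x² y² (x² - y²)²` of degree `8`. -/
noncomputable def gleasonOctic (K : Type*) [Field K] : MvPolynomial (ZMod 2) K :=
  X 0 ^ 2 * X 1 ^ 2 * ((X 0 - X 1) ^ 2 * (X 0 + X 1) ^ 2)

theorem isGleasonInvariant_gleasonQuadratic : IsGleasonInvariant 1 (gleasonQuadratic K) where
  isHomogeneous := (isHomogeneous_X_pow 0 2).add (isHomogeneous_X_pow 1 2)
  twist_eq := by
    simp only [gleasonQuadratic, map_add, map_pow, twist_X_zero, twist_X_one, map_neg, C_1]
    ring
  hadamard_eq := by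
    simp only [gleasonQuadratic, map_add, map_pow, hadamard_X_zero, hadamard_X_one, map_ofNat]
    ring

theorem isGleasonInvariant_gleasonOctic : IsGleasonInvariant 4 (gleasonOctic K) where
  isHomogeneous := ((isHomogeneous_X_pow 0 2).mul (isHomogeneous_X_pow 1 2)).mul
    ((((isHomogeneous_X K 0).sub (isHomogeneous_X K 1)).pow 2).mul
      (((isHomogeneous_X K 0).add (isHomogeneous_X K 1)).pow 2))
  twist_eq := by
    simp only [gleasonOctic, map_add, map_sub, map_mul, map_pow, twist_X_zero, twist_X_one,
      map_neg, C_1]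
    ring
  hadamard_eq := by
    simp only [gleasonOctic, map_add, map_sub, map_mul, map_pow, hadamard_X_zero, hadamard_X_one,
      map_ofNat]
    ring

theorem coeff_gleasonQuadratic_pow (k : ℕ) :
    coeff (Finsupp.single 0 (2 * k)) (gleasonQuadratic K ^ k) = 1 := by
  have dvd : X 1 ^ 2 ∣ gleasonQuadratic K ^ k - (X 0 ^ 2) ^ k :=
    (Dvd.intro_left 1 (by rw [gleasonQuadratic]; ring)).trans (sub_dvd_pow_sub_pow _ _ k)
  have coeff_eq := X_pow_dvd_iff.1 dvd (Finsupp.single 0 (2 * k))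
    (by rw [Finsupp.single_eq_of_ne one_ne_zero]; exact two_pos)
  rwa [coeff_sub, ← pow_mul, coeff_X_pow, if_pos rfl, sub_eq_zero] at coeff_eq

theorem gleasonQuadratic_ne_zero : gleasonQuadratic K ≠ 0 := by
  intro h
  have := coeff_gleasonQuadratic_pow (K := K) 1
  rw [h, zero_pow one_ne_zero, coeff_zero] at this
  exact zero_ne_one this

theorem gleasonOctic_ne_zero : gleasonOctic K ≠ 0 := by
  have add_ne_zero : (X 0 + X 1 : MvPolynomial (ZMod 2) K) ≠ 0 := by
    intro h
    simpa using congrArg (eval fun a => if a = 0 then 1 else 0) h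
  have sub_ne_zero : (X 0 - X 1 : MvPolynomial (ZMod 2) K) ≠ 0 :=
    sub_ne_zero.2 ((X_injective (σ := ZMod 2) (R := K)).ne zero_ne_one)
  exact mul_ne_zero (mul_ne_zero (pow_ne_zero 2 (X_ne_zero 0)) (pow_ne_zero 2 (X_ne_zero 1)))
    (mul_ne_zero (pow_ne_zero 2 sub_ne_zero) (pow_ne_zero 2 add_ne_zero))

theorem gleasonOctic_dvd_of_sq_dvd [NeZero (2 : K)] {F : MvPolynomial (ZMod 2) K}
    (dvd_zero : X 0 ^ 2 ∣ F) (dvd_one : X 1 ^ 2 ∣ F) (dvd_sub : (X 0 - X 1) ^ 2 ∣ F)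
    (dvd_add : (X 0 + X 1) ^ 2 ∣ F) : gleasonOctic K ∣ F := by
  have coprime {a b c d : K} (h : a * d - b * c ≠ 0) :=
    (isRelPrime_linear h.isUnit).pow (m := 2) (n := 2)
  have two : (1 + 1 : K) ≠ 0 := one_add_one_eq_two (R := K) ▸ two_ne_zero
  have zero_one := coprime (a := 1) (b := 0) (c := 0) (d := 1) (by simp)
  have zero_sub := coprime (a := 1) (b := 0) (c := 1) (d := -1) (by simp)
  have zero_add := coprime (a := 1) (b := 0) (c := 1) (d := 1) (by simp)
  have one_sub := coprime (a := 0) (b := 1) (c := 1) (d := -1) (by simp)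
  have one_add := coprime (a := 0) (b := 1) (c := 1) (d := 1) (by simp)
  have sub_add := coprime (a := 1) (b := -1) (c := 1) (d := 1) (by simpa using two)
  simp only [C_0, C_1, C_neg, zero_mul, one_mul, _root_.add_zero, _root_.zero_add, neg_mul,
    ← sub_eq_add_neg] at zero_one zero_sub zero_add one_sub one_add sub_add
  exact ((zero_sub.mul_right zero_add).mul_left (one_sub.mul_right one_add)).mul_dvd
    (zero_one.mul_dvd dvd_zero dvd_one) (sub_add.mul_dvd dvd_sub dvd_add)

namespace IsGleasonInvariant

variable {m l : ℕ} {F G P : MvPolynomial (ZMod 2) K}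

theorem sub (hF : IsGleasonInvariant m F) (hG : IsGleasonInvariant m G) :
    IsGleasonInvariant m (F - G) where
  isHomogeneous := hF.isHomogeneous.sub hG.isHomogeneous
  twist_eq := by rw [map_sub, hF.twist_eq, hG.twist_eq]
  hadamard_eq := by rw [map_sub, hF.hadamard_eq, hG.hadamard_eq, mul_sub]

theorem C_mul (hF : IsGleasonInvariant m F) (c : K) : IsGleasonInvariant m (C c * F) where
  isHomogeneous := hF.isHomogeneous.C_mul c
  twist_eq := by rw [map_mul, algHom_C, algebraMap_eq, hF.twist_eq]
  hadamard_eq := by rw [map_mul, algHom_C, algebraMap_eq, hF.hadamard_eq, mul_left_comm]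

theorem pow (hF : IsGleasonInvariant m F) (k : ℕ) : IsGleasonInvariant (m * k) (F ^ k) where
  isHomogeneous := mul_assoc 2 m k ▸ hF.isHomogeneous.pow k
  twist_eq := by rw [map_pow, hF.twist_eq]
  hadamard_eq := by rw [map_pow, hF.hadamard_eq, mul_pow, pow_mul, map_pow _ (2 ^ m)]

theorem twist_dvd (hF : IsGleasonInvariant m F) (h : P ∣ F) : twist (-1) P ∣ F :=
  hF.twist_eq ▸ map_dvd (twist (-1)) h

variable [NeZero (2 : K)]

theorem exists_mul_of_dvd (hF : IsGleasonInvariant (l + m) F) (hP : IsGleasonInvariant l P)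
    (P_ne_zero : P ≠ 0) (h : P ∣ F) : ∃ G, IsGleasonInvariant m G ∧ F = P * G := by
  obtain ⟨G, hG, rfl⟩ := exists_isHomogeneous_mul_of_dvd hP.isHomogeneous
    (mul_add 2 l m ▸ hF.isHomogeneous) h
  have two_pow_ne_zero : (C (2 ^ l) : MvPolynomial (ZMod 2) K) ≠ 0 :=
    C_ne_zero.2 (pow_ne_zero l two_ne_zero)
  refine ⟨G, ⟨hG, mul_left_cancel₀ P_ne_zero ?_,
    mul_left_cancel₀ (mul_ne_zero two_pow_ne_zero P_ne_zero) ?_⟩, rfl⟩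
  · simpa only [map_mul, hP.twist_eq] using hF.twist_eq
  · calc C (2 ^ l) * P * hadamard G = hadamard (P * G) := by rw [map_mul, hP.hadamard_eq]
      _ = C (2 ^ l) * P * (C (2 ^ m) * G) := by rw [hF.hadamard_eq, pow_add, map_mul]; ring

theorem hadamard_dvd (hF : IsGleasonInvariant m F) (h : P ∣ F) : hadamard P ∣ F := by
  have unit : IsUnit (C (2 ^ m) : MvPolynomial (ZMod 2) K) :=
    ((two_ne_zero (α := K)).isUnit.pow m).map C
  exact unit.dvd_mul_left.1 (hF.hadamard_eq ▸ map_dvd hadamard h)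

theorem X_one_sq_dvd (hF : IsGleasonInvariant m F)
    (h0 : coeff (Finsupp.single 0 (2 * m)) F = 0) : X 1 ^ 2 ∣ F := by
  refine X_pow_dvd_iff.2 fun d hd => ?_
  by_cases degree : d.degree = 2 * m
  · obtain hd0 | hd1 : d 1 = 0 ∨ d 1 = 1 := by omega
    · have : d 0 = 2 * m := by
        rwa [Finsupp.degree_eq_sum, sum_zmod_two, hd0, add_zero] at degree
      have : d = Finsupp.single 0 (2 * m) := by
        ext a
        fin_cases a
        · exact this.trans Finsupp.single_eq_same.symm
        · exact hd0.trans (Finsupp.single_eq_of_ne one_ne_zero).symm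
      rw [this, h0]
    · have even := congrArg (coeff d) hF.twist_eq
      rw [coeff_twist, hd1, pow_one] at even
      have : 2 * coeff d F = 0 := by linear_combination -even
      exact (mul_eq_zero.1 this).resolve_left two_ne_zero
  · exact hF.isHomogeneous.coeff_eq_zero degree

theorem gleasonOctic_dvd (hF : IsGleasonInvariant m F)
    (h0 : coeff (Finsupp.single 0 (2 * m)) F = 0) : gleasonOctic K ∣ F := by
  have dvd_one := hF.X_one_sq_dvd h0
  have dvd_sub : (X 0 - X 1) ^ 2 ∣ F := by
    simpa only [map_pow, hadamard_X_one] using hF.hadamard_dvd dvd_one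
  have dvd_add : (X 0 + X 1) ^ 2 ∣ F := by
    simpa only [map_pow, map_sub, twist_X_zero, twist_X_one, map_neg, C_1, neg_mul, one_mul,
      sub_neg_eq_add] using hF.twist_dvd dvd_sub
  have dvd_zero : X 0 ^ 2 ∣ F := by
    have := hF.hadamard_dvd dvd_add
    rw [map_pow, map_add, hadamard_X_zero, hadamard_X_one, add_add_sub_cancel, ← two_mul,
      mul_pow] at this
    exact (dvd_mul_left _ _).trans this
  exact gleasonOctic_dvd_of_sq_dvd dvd_zero dvd_one dvd_sub dvd_add

theorem exists_eq_sum (hF : IsGleasonInvariant m F) :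
    ∃ c : ℕ → K, F = ∑ j ∈ Finset.range (m / 4 + 1),
      C (c j) * (gleasonQuadratic K ^ (m - 4 * j) * gleasonOctic K ^ j) := by
  induction m using Nat.strong_induction_on generalizing F with
  | h m ih =>
    let c₀ := coeff (Finsupp.single 0 (2 * m)) F
    have quadratic_pow : IsGleasonInvariant m (gleasonQuadratic K ^ m) :=
      by simpa only [one_mul] using isGleasonInvariant_gleasonQuadratic.pow m
    have remainder := hF.sub (quadratic_pow.C_mul c₀)
    have dvd := remainder.gleasonOctic_dvd (by
      rw [coeff_sub, coeff_C_mul, coeff_gleasonQuadratic_pow, mul_one, sub_self])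
    obtain hm | ⟨l, rfl⟩ : m < 4 ∨ ∃ l, m = 4 + l :=
      (lt_or_ge m 4).imp_right Nat.exists_eq_add_of_le
    · refine ⟨fun _ => c₀, ?_⟩
      rw [Nat.div_eq_of_lt hm, zero_add, Finset.sum_range_one, pow_zero, mul_one, mul_zero,
        Nat.sub_zero, ← sub_eq_zero]
      exact eq_zero_of_dvd_of_isHomogeneous isGleasonInvariant_gleasonOctic.isHomogeneous
        remainder.isHomogeneous dvd (by omega)
    · obtain ⟨G, hG, eq⟩ := remainder.exists_mul_of_dvd isGleasonInvariant_gleasonOctic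
        gleasonOctic_ne_zero dvd
      obtain ⟨c, rfl⟩ := ih l (by omega) hG
      refine ⟨fun j => Nat.casesOn j c₀ c, ?_⟩
      rw [Nat.add_div_left l four_pos, Finset.sum_range_succ', mul_zero, Nat.sub_zero, pow_zero,
        mul_one]
      refine sub_eq_iff_eq_add.1 (eq.trans ?_)
      rw [Finset.mul_sum]
      refine Finset.sum_congr rfl fun j _ => ?_
      rw [show 4 + l - 4 * (j + 1) = l - 4 * j by omega, pow_succ]
      ring

end IsGleasonInvariant

end Gleason

section ShadowBound

variable {n : ℕ} {C : BinaryCode n}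

theorem IsSelfDual.isGleasonInvariant_weightEnumerator (hC : IsSelfDual C) :
    IsGleasonInvariant (Module.finrank (ZMod 2) C)
      (weightEnumerator ℂ (C : Set (BinaryVector n))) where
  isHomogeneous := by
    rw [hC.two_mul_finrank]
    exact isHomogeneous_weightEnumerator _
  twist_eq := by
    rw [twist_weightEnumerator fun c hc => (hC.even_hammingNorm hc).neg_one_pow, C_1, one_mul]
  hadamard_eq := hC.hadamard_weightEnumerator

theorem IsSinglyEvenSelfDual.gleasonQuadratic_pow_dvd_weightEnumerator
    (hC : IsSinglyEvenSelfDual C) {s : ℕ} (hs : ∀ v ∈ shadow C, s ≤ hammingNorm v) :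
    gleasonQuadratic ℂ ^ s ∣ weightEnumerator ℂ (C : Set (BinaryVector n)) := by
  have unit : IsUnit (MvPolynomial.C (2 ^ Module.finrank (ZMod 2) C) : MvPolynomial (ZMod 2) ℂ) :=
    (two_ne_zero.isUnit.pow _).map MvPolynomial.C
  have dvd_twist : (X 0 - X 1) ^ s ∣
      twist Complex.I (weightEnumerator ℂ (C : Set (BinaryVector n))) := by
    have := map_dvd hadamard (X_one_pow_dvd_weightEnumerator (K := ℂ) hs)
    rwa [map_pow, hadamard_X_one, hC.hadamard_weightEnumerator_shadow, unit.dvd_mul_left] at this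
  have dvd_add : (X 0 + MvPolynomial.C Complex.I * X 1) ^ s ∣
      weightEnumerator ℂ (C : Set (BinaryVector n)) := by
    have := map_dvd (twist (-Complex.I)) dvd_twist
    rwa [twist_twist, neg_mul, Complex.I_mul_I, neg_neg, twist_one, map_pow, map_sub, twist_X_zero,
      twist_X_one, C_neg, neg_mul, sub_neg_eq_add] at this
  have dvd_sub : (X 0 - MvPolynomial.C Complex.I * X 1) ^ s ∣
      weightEnumerator ℂ (C : Set (BinaryVector n)) := by
    have := hC.1.isGleasonInvariant_weightEnumerator.twist_dvd dvd_add
    rwa [map_pow, map_add, map_mul, algHom_C, algebraMap_eq, twist_X_zero, twist_X_one, C_neg, C_1,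
      neg_mul, one_mul, mul_neg, ← sub_eq_add_neg] at this
  have coprime := isRelPrime_linear (a := 1) (b := Complex.I) (c := 1) (d := -Complex.I)
    (by norm_num [← neg_add', ← two_mul])
  rw [C_1, one_mul, C_neg, neg_mul, ← sub_eq_add_neg] at coprime
  refine (dvd_of_eq ?_).trans (coprime.pow.mul_dvd dvd_add dvd_sub)
  rw [gleasonQuadratic, ← mul_pow, ← sq_sub_sq, mul_pow, ← C_pow, Complex.I_sq, C_neg, C_1, neg_mul,
    one_mul, sub_neg_eq_add]

theorem weightEnumerator_ne_zero (C : BinaryCode n) :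
    weightEnumerator ℂ (C : Set (BinaryVector n)) ≠ 0 := by
  intro h
  have := congrArg (eval 1) h
  simp only [weightEnumerator, weightMonomial, map_sum, map_prod, eval_X, Pi.one_apply,
    Finset.prod_const_one, Finset.sum_const, nsmul_one, card_toFinset_eq_two_pow_finrank,
    map_zero, Nat.cast_eq_zero] at this
  exact pow_ne_zero _ two_ne_zero this

theorem IsSinglyEvenSelfDual.exists_weightEnumerator_eq_sum (hC : IsSinglyEvenSelfDual C) {s : ℕ}
    (hs : ∀ v ∈ shadow C, s ≤ hammingNorm v) :
    ∃ (r : ℕ) (c : ℕ → ℂ), Module.finrank (ZMod 2) C = s + r ∧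
      weightEnumerator ℂ (C : Set (BinaryVector n)) = ∑ j ∈ Finset.range (r / 4 + 1),
        MvPolynomial.C (c j) * (gleasonQuadratic ℂ ^ (s + r - 4 * j) * gleasonOctic ℂ ^ j) := by
  have quadratic_pow : IsGleasonInvariant s (gleasonQuadratic ℂ ^ s) := by
    simpa only [one_mul] using isGleasonInvariant_gleasonQuadratic.pow s
  have enumerator := hC.1.isGleasonInvariant_weightEnumerator
  have dvd := hC.gleasonQuadratic_pow_dvd_weightEnumerator hs
  have le : s ≤ Module.finrank (ZMod 2) C := by
    by_contra! lt
    exact weightEnumerator_ne_zero C (eq_zero_of_dvd_of_isHomogeneous quadratic_pow.isHomogeneous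
      enumerator.isHomogeneous dvd (by omega))
  obtain ⟨r, m_eq⟩ := Nat.exists_eq_add_of_le le
  rw [m_eq] at enumerator
  obtain ⟨G, hG, eq⟩ := enumerator.exists_mul_of_dvd quadratic_pow
    (pow_ne_zero s gleasonQuadratic_ne_zero) dvd
  obtain ⟨c, rfl⟩ := hG.exists_eq_sum
  refine ⟨r, c, m_eq, ?_⟩
  rw [eq, Finset.mul_sum]
  refine Finset.sum_congr rfl fun j hj => ?_
  have := Finset.mem_range.1 hj
  rw [show s + r - 4 * j = s + (r - 4 * j) by omega, pow_add]
  ring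

end ShadowBound

end Enumerator

section Lagrange

open PowerSeries

section EvenGeometricSeries

/-- The power series `1 + X ^ 2 + X ^ 4 + ⋯`, the expansion of `(1 - X ^ 2)⁻¹`, over a semiring, so
that the positivity of its coefficients can be used in `ℕ`. -/
def evenGeometricSeries (R : Type*) [Semiring R] : R⟦X⟧ :=
  .mk fun i => if Even i then 1 else 0

theorem map_evenGeometricSeries {R S : Type*} [Semiring R] [Semiring S] (f : R →+* S) :
    map f (evenGeometricSeries R) = evenGeometricSeries S := by
  ext i
  rw [coeff_map, evenGeometricSeries, evenGeometricSeries, coeff_mk, coeff_mk, apply_ite f, map_one,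
    map_zero]

theorem constantCoeff_evenGeometricSeries (R : Type*) [Semiring R] :
    constantCoeff (evenGeometricSeries R) = 1 := by
  rw [← coeff_zero_eq_constantCoeff_apply, evenGeometricSeries, coeff_mk, if_pos Even.zero]

theorem one_add_X_mul_evenGeometricSeries (R : Type*) [Semiring R] :
    (1 + X) * evenGeometricSeries R = .mk fun _ => 1 := by
  ext i
  rw [add_mul, one_mul, map_add]
  rcases i with _ | i
  · simp [evenGeometricSeries]
  · rw [coeff_succ_X_mul]
    simp only [evenGeometricSeries, coeff_mk, Nat.even_add_one]
    split_ifs <;> simp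

variable (R : Type*) [CommRing R]

theorem one_sub_X_mul_one_add_X_mul_evenGeometricSeries :
    (1 - X) * ((1 + X) * evenGeometricSeries R) = 1 := by
  rw [one_add_X_mul_evenGeometricSeries, mul_comm]
  exact mk_one_mul_one_sub_eq_one R

theorem evalNegHom_evenGeometricSeries :
    evalNegHom (evenGeometricSeries R) = evenGeometricSeries R := by
  ext i
  rw [evalNegHom, coeff_rescale, evenGeometricSeries, coeff_mk]
  split_ifs with even
  · rw [even.neg_one_pow, one_mul]
  · rw [mul_zero]

theorem coeff_mul_ne_zero_of_nat {q : ℕ} {f g : ℕ⟦X⟧} (hf : coeff q f ≠ 0)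
    (hg : constantCoeff g ≠ 0) : coeff q (f * g) ≠ 0 := by
  rw [coeff_mul]
  refine (Finset.sum_pos' (fun _ _ => Nat.zero_le _) ⟨(q, 0), ?_, ?_⟩).ne'
  · exact Finset.HasAntidiagonal.mem_antidiagonal.2 (add_zero q)
  · exact Nat.mul_pos hf.pos (by rwa [coeff_zero_eq_constantCoeff, Nat.pos_iff_ne_zero])

variable [CharZero R] (a b q : ℕ)

theorem coeff_evenGeometricSeries_pow_ne_zero (hq : Even q) :
    coeff q (evenGeometricSeries R ^ (b + 1)) ≠ 0 := by
  rw [← map_evenGeometricSeries (Nat.castRingHom R), ← map_pow, coeff_map, pow_succ',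
    eq_natCast, Nat.cast_ne_zero]
  refine coeff_mul_ne_zero_of_nat ?_ ?_
  · rw [evenGeometricSeries, coeff_mk, if_pos hq]
    exact one_ne_zero
  · rw [map_pow, constantCoeff_evenGeometricSeries, one_pow]
    exact one_ne_zero

theorem coeff_one_add_X_pow_mul_evenGeometricSeries_pow_ne_zero :
    coeff q ((1 + X) ^ (a + 1) * evenGeometricSeries R ^ (b + 1)) ≠ 0 := by
  have nat : (1 + X) ^ (a + 1) * evenGeometricSeries R ^ (b + 1) = map (Nat.castRingHom R)
      ((1 + X) * evenGeometricSeries ℕ * ((1 + X) ^ a * evenGeometricSeries ℕ ^ b)) := by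
    simp only [map_mul, map_pow, map_add, map_one, map_X, map_evenGeometricSeries]
    ring
  rw [nat, coeff_map, eq_natCast, Nat.cast_ne_zero]
  refine coeff_mul_ne_zero_of_nat ?_ ?_
  · rw [one_add_X_mul_evenGeometricSeries, coeff_mk]
    exact one_ne_zero
  · simp only [map_mul, map_pow, map_add, map_one, constantCoeff_X, add_zero,
      constantCoeff_evenGeometricSeries, one_pow, mul_one, ne_eq, one_ne_zero, not_false_eq_true]

theorem coeff_one_sub_X_pow_mul_evenGeometricSeries_pow_ne_zero :
    coeff q ((1 - X) ^ (a + 1) * evenGeometricSeries R ^ (b + 1)) ≠ 0 := by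
  have reflect : (1 - X) ^ (a + 1) * evenGeometricSeries R ^ (b + 1) =
      evalNegHom ((1 + X) ^ (a + 1) * evenGeometricSeries R ^ (b + 1)) := by
    rw [map_mul, map_pow, map_pow, map_add, map_one, evalNegHom_X, evalNegHom_evenGeometricSeries,
      ← sub_eq_add_neg]
  rw [reflect, evalNegHom, coeff_rescale]
  exact (isUnit_neg_one.pow q).mul_right_eq_zero.not.2
    (coeff_one_add_X_pow_mul_evenGeometricSeries_pow_ne_zero R a b q)

end EvenGeometricSeries

section Extraction

variable {K : Type*} [CommRing K] [IsDomain K] [CharZero K] {h k : K⟦X⟧}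

-- With `y = X * k`, this is the residue of `(y ^ j)' / y ^ (j + r + 1)`, a multiple of the
-- derivative of the Laurent series `y ^ (-(r + 1))`.
theorem coeff_derivative_X_mul_pow_mul_pow (hk : h * k = 1) (j r : ℕ) :
    coeff (j + r) (d⁄dX K ((X * k) ^ j) * h ^ (j + r + 1)) = 0 := by
  have cancel (i : ℕ) : (X * k) ^ j * h ^ (j + i) = X ^ j * h ^ i := by
    have : (h * k) ^ j = 1 := by rw [hk, one_pow]
    linear_combination X ^ j * h ^ i * this
  have leibniz := congrArg (d⁄dX K) (cancel (r + 1))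
  rw [Derivation.leibniz, smul_eq_mul, smul_eq_mul, ← add_assoc, derivative_pow h,
    Nat.add_sub_cancel] at leibniz
  have coeff_right : coeff (j + r) (d⁄dX K (X ^ j * h ^ (r + 1))) =
      coeff (r + 1) (h ^ (r + 1)) * (j + r + 1) := by
    rw [coeff_derivative, add_assoc j r 1, coeff_X_pow_mul', if_pos (Nat.le_add_right _ _),
      Nat.add_sub_cancel_left, Nat.cast_add]
  have coeff_left : coeff (j + r) (X ^ j * d⁄dX K (h ^ (r + 1))) =
      coeff (r + 1) (h ^ (r + 1)) * (r + 1) := by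
    rw [coeff_X_pow_mul', if_pos (Nat.le_add_right _ _), Nat.add_sub_cancel_left, coeff_derivative]
  rw [derivative_pow, Nat.add_sub_cancel] at coeff_left
  have combination : C (r + 1 : K) * (d⁄dX K ((X * k) ^ j) * h ^ (j + r + 1)) =
      C (r + 1 : K) * d⁄dX K (X ^ j * h ^ (r + 1)) -
        C (j + r + 1 : K) * (X ^ j * (((r + 1 : ℕ) : K⟦X⟧) * h ^ r * d⁄dX K h)) := by
    rw [← leibniz]
    simp only [map_add, map_natCast, map_one]
    push_cast
    linear_combination (-(r : K⟦X⟧) - 1) * (j + r + 1) * d⁄dX K h * cancel r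
  have coeffs := congrArg (coeff (j + r)) combination
  rw [map_sub, coeff_C_mul, coeff_C_mul, coeff_C_mul, coeff_right, coeff_left] at coeffs
  have r_ne_zero : (r + 1 : K) ≠ 0 := Nat.cast_add_one_ne_zero r
  exact (mul_eq_zero.1 (coeffs.trans (by ring))).resolve_left r_ne_zero

theorem coeff_derivative_mul_pow_eq_zero (hk : h * k = 1) {q : ℕ} (c : ℕ → K) {F : K⟦X⟧}
    (hF : X ^ (q + 2) ∣ F - ∑ j ∈ Finset.range (q + 1), C (c j) * (X * k) ^ j) :
    coeff q (d⁄dX K F * h ^ (q + 1)) = 0 := by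
  obtain ⟨R, hR⟩ := hF
  have tail : d⁄dX K (X ^ (q + 2) * R) * h ^ (q + 1) =
      X ^ (q + 1) * ((X * d⁄dX K R + ((q + 2 : ℕ) : K⟦X⟧) * R) * h ^ (q + 1)) := by
    rw [Derivation.leibniz, derivative_pow, derivative_X, smul_eq_mul, smul_eq_mul,
      Nat.add_sub_cancel_right (m := 1) (n := q + 1)]
    ring
  rw [eq_add_of_sub_eq hR, map_add, add_mul, map_add, tail, coeff_X_pow_mul',
    if_neg (by omega), zero_add, map_sum, Finset.sum_mul, map_sum]
  refine Finset.sum_eq_zero fun j hj => ?_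
  obtain ⟨r, rfl⟩ := Nat.exists_eq_add_of_le (Nat.lt_succ_iff.1 (Finset.mem_range.1 hj))
  rw [Derivation.leibniz, derivative_C, smul_zero, add_zero, smul_eq_mul, mul_assoc, coeff_C_mul,
    coeff_derivative_X_mul_pow_mul_pow hk, mul_zero]

end Extraction

section OctahedralExpansion

variable {K : Type*} [CommRing K]

theorem eq_and_odd_of_coeff_eq_zero [CharZero K] {q m : ℕ}
    (h : coeff q ((1 - X) ^ (m + 1) * (1 + X) ^ (6 * (q + 1)) *
      evenGeometricSeries K ^ (m + 1 + 2 * (q + 1))) = 0) :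
    m = 6 * q + 5 ∧ Odd q := by
  have cancel (i : ℕ) :
      (1 - X) ^ i * (1 + X) ^ i * evenGeometricSeries K ^ i = 1 := by
    rw [← mul_pow, ← mul_pow, mul_assoc, one_sub_X_mul_one_add_X_mul_evenGeometricSeries, one_pow]
  rcases lt_trichotomy (m + 1) (6 * (q + 1)) with lt | eq | gt
  · obtain ⟨a, ha⟩ := Nat.exists_eq_add_of_lt lt
    refine absurd h ?_
    convert coeff_one_add_X_pow_mul_evenGeometricSeries_pow_ne_zero K a (2 * q + 1) q using 3
    rw [ha]
    linear_combination
      (1 + X) ^ (a + 1) * evenGeometricSeries K ^ (2 * q + 2) * cancel (m + 1)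
  · refine ⟨by omega, Nat.not_even_iff_odd.1 fun even => ?_⟩
    rw [eq, pow_add, ← mul_assoc, cancel, one_mul] at h
    exact coeff_evenGeometricSeries_pow_ne_zero K (2 * q + 1) q even h
  · obtain ⟨a, ha⟩ := Nat.exists_eq_add_of_lt gt
    refine absurd h ?_
    convert coeff_one_sub_X_pow_mul_evenGeometricSeries_pow_ne_zero K a (a + 2 * q + 2) q using 3
    rw [ha]
    linear_combination (1 - X) ^ (a + 1) * evenGeometricSeries K ^ (a + 2 * q + 3) *
      cancel (6 * (q + 1))

theorem derivative_pow_of_one_add_X_mul_eq_one {U : K⟦X⟧} (hU : (1 + X) * U = 1) (m : ℕ) :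
    d⁄dX K (U ^ m) = -(m * U ^ (m + 1)) := by
  have derivative_U : d⁄dX K U = -U ^ 2 := by
    have leibniz := congrArg (d⁄dX K) hU
    rw [Derivation.leibniz, smul_eq_mul, smul_eq_mul, derivative_one, map_add, derivative_one,
      derivative_X] at leibniz
    linear_combination U * leibniz - d⁄dX K U * hU
  rcases m with _ | m
  · simp
  · rw [derivative_pow, derivative_U, Nat.add_sub_cancel]
    ring

theorem pow_mul_sum_mul_pow_eq {u U : K} (hU : u * U = 1) {q m : ℕ} (hqm : 4 * q ≤ m)
    (c : ℕ → K) (t : K) :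
    U ^ m * ∑ j ∈ Finset.range (q + 1), c j * (u ^ (m - 4 * j) * t ^ j) =
      ∑ j ∈ Finset.range (q + 1), c j * (t * U ^ 4) ^ j := by
  rw [Finset.mul_sum]
  refine Finset.sum_congr rfl fun j hj => ?_
  obtain ⟨i, rfl⟩ := Nat.exists_eq_add_of_le
    ((Nat.mul_le_mul_left 4 (Nat.lt_succ_iff.1 (Finset.mem_range.1 hj))).trans hqm)
  have cancel : u ^ i * U ^ i = 1 := by rw [← mul_pow, hU, one_pow]
  rw [Nat.add_sub_cancel_left]
  linear_combination c j * (t * U ^ 4) ^ j * cancel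

/-- Lagrange inversion for the substitution `X * (1 - X) ^ 2 / (1 + X) ^ 4`. -/
theorem eq_and_odd_of_X_pow_dvd [IsDomain K] [CharZero K] {q m : ℕ} (hqm : 4 * q ≤ m) (hm : m ≠ 0)
    (c : ℕ → K)
    (h : X ^ (q + 2) ∣ ∑ j ∈ Finset.range (q + 1),
      C (c j) * ((1 + X) ^ (m - 4 * j) * (X * (1 - X) ^ 2) ^ j) - 1) :
    m = 6 * q + 5 ∧ Odd q := by
  have geometric := one_sub_X_mul_one_add_X_mul_evenGeometricSeries K
  set E := evenGeometricSeries K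
  set U := (1 - X) * E with hU
  set V := (1 + X) * E with hV
  have inv_U : (1 + X) * U = 1 := by linear_combination geometric
  have inverse : ((1 + X) ^ 4 * V ^ 2) * ((1 - X) ^ 2 * U ^ 4) = 1 := by
    calc _ = ((1 + X) * U) ^ 4 * ((1 - X) * V) ^ 2 := by ring
      _ = 1 := by rw [inv_U, geometric, one_pow, one_pow, one_mul]
  have dvd : X ^ (q + 2) ∣ U ^ m -
      ∑ j ∈ Finset.range (q + 1), C (c j) * (X * ((1 - X) ^ 2 * U ^ 4)) ^ j := by
    simp only [← mul_assoc X, ← pow_mul_sum_mul_pow_eq inv_U hqm]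
    convert (h.mul_left (U ^ m)).neg_right using 1
    ring
  have coeff_eq := coeff_derivative_mul_pow_eq_zero inverse c dvd
  have product (u w : K⟦X⟧) : (w * E) ^ (m + 1) * (u ^ 4 * (u * E) ^ 2) ^ (q + 1) =
      w ^ (m + 1) * u ^ (6 * (q + 1)) * E ^ (m + 1 + 2 * (q + 1)) := by ring
  rw [derivative_pow_of_one_add_X_mul_eq_one inv_U, neg_mul, mul_assoc, hU, hV, product, map_neg,
    neg_eq_zero, ← map_natCast (C (R := K)), coeff_C_mul] at coeff_eq
  exact eq_and_odd_of_coeff_eq_zero ((mul_eq_zero.1 coeff_eq).resolve_left (Nat.cast_ne_zero.2 hm))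

end OctahedralExpansion

end Lagrange

section MinimumWeight

variable {n : ℕ} {C : BinaryCode n}

open PowerSeries in
/-- Setting `X 0 = 1` and `X 1 ^ 2 = X` in the weight enumerator. -/
theorem IsSelfDual.sum_X_pow_half_hammingNorm_eq {m N : ℕ} (hC : IsSelfDual C) (c : ℕ → ℂ)
    (h : weightEnumerator ℂ (C : Set (BinaryVector n)) = ∑ j ∈ Finset.range N,
      MvPolynomial.C (c j) * (gleasonQuadratic ℂ ^ (m - 4 * j) * gleasonOctic ℂ ^ j)) :
    ∑ x ∈ (C : Set (BinaryVector n)).toFinite.toFinset, X ^ (hammingNorm x / 2) =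
      ∑ j ∈ Finset.range N,
        PowerSeries.C (c j) * ((1 + X) ^ (m - 4 * j) * (X * (1 - X) ^ 2) ^ j) := by
  have expand_injective : Function.Injective (expand (R := ℂ) 2 two_ne_zero) := fun f g hfg => by
    ext i
    rw [← coeff_expand_mul 2 two_ne_zero f, hfg, coeff_expand_mul]
  let dehomogenize : MvPolynomial (ZMod 2) ℂ →ₐ[ℂ] ℂ⟦X⟧ :=
    MvPolynomial.aeval fun a => if a = 0 then 1 else X
  have apply_zero : dehomogenize (MvPolynomial.X 0) = 1 := MvPolynomial.aeval_X _ 0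
  have apply_one : dehomogenize (MvPolynomial.X 1) = X := MvPolynomial.aeval_X _ 1
  have apply_C (a : ℂ) : dehomogenize (MvPolynomial.C a) = PowerSeries.C a :=
    MvPolynomial.algHom_C _ a
  have quadratic : dehomogenize (gleasonQuadratic ℂ) = 1 + X ^ 2 := by
    rw [gleasonQuadratic, map_add, map_pow, map_pow, apply_zero, apply_one, one_pow]
  have octic : dehomogenize (gleasonOctic ℂ) = X ^ 2 * (1 - X ^ 2) ^ 2 := by
    simp only [gleasonOctic, map_mul, map_pow, map_sub, map_add, apply_zero, apply_one]
    ring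
  apply expand_injective
  have image := congrArg dehomogenize h
  simp only [weightEnumerator, weightMonomial_eq, map_sum, map_mul, map_pow, apply_zero, apply_one,
    apply_C, quadratic, octic, one_pow, one_mul] at image
  simp only [map_sum, map_mul, map_pow, map_add, map_sub, map_one, expand_X, expand_C]
  rw [← image]
  refine Finset.sum_congr rfl fun x hx => ?_
  rw [← pow_mul,
    Nat.mul_div_cancel' (hC.even_hammingNorm ((Set.toFinite _).mem_toFinset.1 hx)).two_dvd]

open PowerSeries in
theorem X_pow_dvd_sum_X_pow_half_hammingNorm_sub_one {R : Type*} [CommRing R] {l : ℕ}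
    (hl : ∀ x ∈ C, x ≠ 0 → l ≤ hammingNorm x / 2) :
    X ^ l ∣ ∑ x ∈ (C : Set (BinaryVector n)).toFinite.toFinset,
      (X : R⟦X⟧) ^ (hammingNorm x / 2) - 1 := by
  have zero_mem : (0 : BinaryVector n) ∈ (C : Set (BinaryVector n)).toFinite.toFinset :=
    (Set.toFinite _).mem_toFinset.2 C.zero_mem
  rw [← Finset.add_sum_erase _ _ zero_mem, hammingNorm_zero, Nat.zero_div, pow_zero,
    add_sub_cancel_left]
  refine Finset.dvd_sum fun x hx => pow_dvd_pow X ?_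
  obtain ⟨ne_zero, hx⟩ := Finset.mem_erase.1 hx
  exact hl x ((Set.toFinite _).mem_toFinset.1 hx) ne_zero

namespace IsSinglyEvenSelfDual

/-- The bound of Bachoc and Gaborit. -/
theorem add_two_mul_le (hC : IsSinglyEvenSelfDual C) {d s : ℕ}
    (hd : ∀ x ∈ C, x ≠ 0 → d ≤ hammingNorm x) (hs : ∀ v ∈ shadow C, s ≤ hammingNorm v)
    (hn : n % 24 = 22 → d ≤ 4 * (n / 24) + 4) : s + 2 * d ≤ n / 2 + 4 := by
  by_contra! gt
  obtain ⟨r, c, finrank_eq, enumerator_eq⟩ := hC.exists_weightEnumerator_eq_sum hs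
  have length_eq := hC.1.two_mul_finrank
  have half_le : ∀ x ∈ C, x ≠ 0 → r / 4 + 2 ≤ hammingNorm x / 2 := fun x hx ne_zero => by
    have := hd x hx ne_zero
    have := Nat.even_iff.1 (hC.1.even_hammingNorm hx)
    omega
  have length_ne_zero : n ≠ 0 := by
    rintro rfl
    obtain ⟨x, -, hx⟩ := hC.2
    rw [Subsingleton.elim x 0, hammingNorm_zero] at hx
    exact absurd hx (by decide)
  have dvd := X_pow_dvd_sum_X_pow_half_hammingNorm_sub_one (R := ℂ) half_le
  rw [hC.1.sum_X_pow_half_hammingNorm_eq c enumerator_eq] at dvd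
  obtain ⟨eq, a, ha⟩ := eq_and_odd_of_X_pow_dvd (by omega) (by omega) c dvd
  omega

theorem hasMinWeight_of_le (hC : IsSinglyEvenSelfDual C) {d s : ℕ} (hd0 : d ≠ 0) (hs0 : s ≠ 0)
    (hn : n % 24 ≠ 22) (hd : ∀ x ∈ C, x ≠ 0 → d ≤ hammingNorm x)
    (hs : ∀ v ∈ shadow C, s ≤ hammingNorm v) (h : n / 2 + 4 ≤ s + 2 * d) :
    HasMinWeight (C : Set (BinaryVector n)) d ∧ HasMinWeight (shadow C) s := by
  refine ⟨⟨⟨hd0, ?_⟩, ?_⟩, ⟨hs0, ?_⟩, ?_⟩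
  · by_contra! ne
    have := hC.add_two_mul_le (fun x hx hx0 => (hd x hx hx0).lt_of_ne' (ne x hx)) hs
      (fun h => absurd h hn)
    omega
  · rintro w ⟨w_ne_zero, x, hx, rfl⟩
    exact hd x hx (hammingNorm_ne_zero_iff.1 w_ne_zero)
  · by_contra! ne
    have := hC.add_two_mul_le hd (fun v hv => (hs v hv).lt_of_ne' (ne v hv))
      (fun h => absurd h hn)
    omega
  · rintro w ⟨-, v, hv, rfl⟩
    exact hs v hv

theorem isSExtremal_of_hasMinWeight (hC : IsSinglyEvenSelfDual C) {d s : ℕ} (hn : n % 24 ≠ 22)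
    (hd : HasMinWeight (C : Set (BinaryVector n)) d) (hs : HasMinWeight (shadow C) s)
    (h : s + 2 * d = n / 2 + 4) : IsSExtremal C :=
  ⟨hC, d, s, hd, hs, by rwa [if_neg fun h => hn h.1]⟩

end IsSinglyEvenSelfDual

theorem IsSelfDual.isExtremal_of_hasMinWeight (hC : IsSelfDual C) (hn : n % 24 ≠ 22)
    (hd : HasMinWeight (C : Set (BinaryVector n)) (4 * (n / 24) + 4)) : IsExtremal C :=
  ⟨hC, by rwa [if_neg hn]⟩

theorem IsSExtremal.hasMinWeight_shadow (hC : IsSExtremal C) {d s : ℕ} (hn : n % 24 ≠ 22)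
    (hd : HasMinWeight (C : Set (BinaryVector n)) d) (h : s + 2 * d = n / 2 + 4) :
    HasMinWeight (shadow C) s := by
  obtain ⟨-, d', s', hd', hs', h'⟩ := hC
  rw [if_neg fun h => hn h.1, hd'.unique hd, ← h] at h'
  exact Nat.add_right_cancel h' ▸ hs'

theorem HasMinWeight.le {D : Set (BinaryVector n)} {d : ℕ} (hD : HasMinWeight D d)
    {x : BinaryVector n} (hx : x ∈ D) (ne_zero : x ≠ 0) : d ≤ hammingNorm x :=
  hD.2 ⟨hammingNorm_ne_zero_iff.2 ne_zero, x, hx, rfl⟩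

end MinimumWeight

section Neighbors

variable {n : ℕ} {C : BinaryCode n}

theorem ShadowNeighborsSatisfy.imp {P Q : BinaryCode n → Prop} (h : ShadowNeighborsSatisfy C P)
    (hPQ : ∀ N, P N → Q N) : ShadowNeighborsSatisfy C Q := by
  refine ⟨h.1, fun C₁ C₂ C₃ hC => ?_⟩
  obtain ⟨N₁, N₃, eq₁, eq₃, neighbor₁, neighbor₃, h₁, h₃⟩ := h.2 C₁ C₂ C₃ hC
  exact ⟨N₁, N₃, eq₁, eq₃, neighbor₁, neighbor₃, hPQ N₁ h₁, hPQ N₃ h₃⟩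

namespace IsSinglyEvenSelfDual

variable {v x : BinaryVector n} {d s : ℕ}

-- For even `d` the least integers `≥ d` congruent to `0` and to `2` modulo `4` are `d + d % 4` and
-- `d + (d + 2) % 4`.
theorem min_le_hammingNorm_of_mem_shadowNeighbor (hC : IsSinglyEvenSelfDual C)
    (hv : v ∈ shadow C) (d_even : Even d) (hd : ∀ x ∈ C, x ≠ 0 → d ≤ hammingNorm x)
    (hs : ∀ v ∈ shadow C, s ≤ hammingNorm v) (hx : x ∈ shadowNeighbor C v) (ne_zero : x ≠ 0) :
    min (d + d % 4) s ≤ hammingNorm x := by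
  rw [Nat.even_iff] at d_even
  rcases hC.mem_or_mem_of_mem_shadowNeighbor hv hx with ⟨hx, hx4⟩ | hx
  · have := hd x hx ne_zero
    omega
  · exact min_le_of_right_le (hs x hx)

theorem min_le_hammingNorm_of_mem_shadow_shadowNeighbor (hC : IsSinglyEvenSelfDual C)
    (hv : v ∈ shadow C) (d_even : Even d) (hd : ∀ x ∈ C, x ≠ 0 → d ≤ hammingNorm x)
    (hs : ∀ v ∈ shadow C, s ≤ hammingNorm v) (hx : x ∈ shadow (shadowNeighbor C v)) :
    min (d + (d + 2) % 4) s ≤ hammingNorm x := by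
  rw [Nat.even_iff] at d_even
  rcases hC.mem_or_mem_of_mem_shadow_shadowNeighbor hv hx with ⟨hxC, hx0⟩ | hx
  · have := hd x hxC fun x_eq => hx0 (x_eq ▸ zero_mem_doublyEvenPart)
    have := Nat.even_iff.1 (hC.1.even_hammingNorm hxC)
    have : hammingNorm x % 4 ≠ 0 := fun h4 => hx0 ⟨hxC, h4⟩
    omega
  · exact min_le_of_right_le (hs x hx)

end IsSinglyEvenSelfDual

theorem IsSExtremal.shadowNeighborsSatisfy (hC : IsSExtremal C) {m d s d' s' : ℕ}
    (hd : HasParameters C m d) (hm : m % 4 = 2) (h : s + 2 * d = m + 4)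
    (hd' : d' = min (d + d % 4) s) (hs' : s' = min (d + (d + 2) % 4) s)
    (h' : s' + 2 * d' = m + 4) :
    ShadowNeighborsSatisfy C fun N => IsSExtremal N ∧ HasParameters N m d' := by
  obtain ⟨finrank_eq, hd⟩ := hd
  have length_eq := hC.1.1.two_mul_finrank
  have hs := hC.hasMinWeight_shadow (s := s) (by omega) hd (by omega)
  replace hC := hC.1
  have mod_four : ∀ v ∈ shadow C, hammingNorm v % 4 = 2 := fun v hv => by
    rw [hC.hammingNorm_mod_four_of_mem_shadow hv, finrank_eq, hm]
  have le_shadow : ∀ v ∈ shadow C, s ≤ hammingNorm v := fun v hv => hs.le hv fun v_eq =>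
    hv.2 (v_eq ▸ C.zero_mem)
  have d_even : Even d := by
    obtain ⟨-, x, hx, rfl⟩ := hd.1
    exact hC.1.even_hammingNorm hx
  refine hC.shadowNeighborsSatisfy (fun v hv => ?_) fun v hv => ?_
  · rw [Nat.even_iff, ← Nat.mod_mod_of_dvd _ (by decide : 2 ∣ 4), mod_four v hv]
  have hN := hC.isSinglyEvenSelfDual_shadowNeighbor hv (mod_four v hv)
  have ⟨d_ne_zero, _⟩ := hd.1
  have ⟨s_ne_zero, _⟩ := hs.1
  obtain ⟨min_neighbor, min_shadow⟩ := hN.hasMinWeight_of_le (d := d') (s := s')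
    (by omega) (by omega) (by omega)
    (fun x hx ne_zero => hd' ▸ hC.min_le_hammingNorm_of_mem_shadowNeighbor hv d_even
      (fun _ => hd.le) le_shadow hx ne_zero)
    (fun x hx => hs' ▸ hC.min_le_hammingNorm_of_mem_shadow_shadowNeighbor hv d_even
      (fun _ => hd.le) le_shadow hx)
    (by omega)
  have finrank_neighbor := hN.1.two_mul_finrank
  exact ⟨hN.isSExtremal_of_hasMinWeight (by omega) min_neighbor min_shadow (by omega),
    by omega, min_neighbor⟩

end Neighbors

end BinaryCode

theorem proposition1 (k : ℕ) :
    (∀ C : BinaryCode (24 * k + 4),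
      BinaryCode.IsSExtremal C → BinaryCode.HasParameters C (12 * k + 2) (4 * k + 2) →
        BinaryCode.ShadowNeighborsSatisfy C fun N =>
          BinaryCode.IsSExtremal N ∧ BinaryCode.HasParameters N (12 * k + 2) (4 * k + 2)) ∧
    (∀ C : BinaryCode (24 * k + 20),
      BinaryCode.IsSExtremal C → BinaryCode.IsExtremal C →
      BinaryCode.HasParameters C (12 * k + 10) (4 * k + 4) →
        BinaryCode.ShadowNeighborsSatisfy C fun N =>
          BinaryCode.IsSExtremal N ∧ BinaryCode.IsExtremal N ∧
            BinaryCode.HasParameters N (12 * k + 10) (4 * k + 4)) ∧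
    (∀ C : BinaryCode (24 * k + 12),
      BinaryCode.IsSExtremal C → BinaryCode.HasParameters C (12 * k + 6) (4 * k + 2) →
        BinaryCode.ShadowNeighborsSatisfy C fun N =>
          BinaryCode.IsSExtremal N ∧ BinaryCode.IsExtremal N ∧
            BinaryCode.HasParameters N (12 * k + 6) (4 * k + 4)) := by
  refine ⟨fun C hC hd => ?_, fun C hC _ hd => ?_, fun C hC hd => ?_⟩
  · exact hC.shadowNeighborsSatisfy (s := 4 * k + 2) (s' := 4 * k + 2) hd
      (by omega) (by omega) (by omega) (by omega) (by omega)
  · refine (hC.shadowNeighborsSatisfy (s := 4 * k + 6) (d' := 4 * k + 4) (s' := 4 * k + 6) hd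
      (by omega) (by omega) (by omega) (by omega) (by omega)).imp fun N hN => ⟨hN.1, ?_, hN.2⟩
    exact hN.1.1.1.isExtremal_of_hasMinWeight (by omega) (by convert hN.2.2 using 2; omega)
  · refine (hC.shadowNeighborsSatisfy (s := 4 * k + 6) (d' := 4 * k + 4) (s' := 4 * k + 2) hd
      (by omega) (by omega) (by omega) (by omega) (by omega)).imp fun N hN => ⟨hN.1, ?_, hN.2⟩
    exact hN.1.1.1.isExtremal_of_hasMinWeight (by omega) (by convert hN.2.2 using 2; omega)
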